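/- Let $G$ be a connected finite graph with $n$ vertices and $m$ edges (more precisely, consider a sequence of such graphs with $n\to\infty$; all asymptotic notation refers to $n\to\infty$). Let $P(v,u)=\mathbf 1_{\{v,u\}\in E}/d(v)$ be the transition matrix of the simple random walk on $G$, let $\pi_v=d(v)/2m$, $\pi_{\min}=\min_v\pi_v$, and let $\lambda$ be the second largest eigenvalue of $P$ in absolute value (eigenvalues counted with multiplicity, one copy of the eigenvalue $1$ being removed). In asynchronous discrete incremental voting (vertex process) every vertex $v$ initially holds an integer opinion $X_v(0)\in\{1,\dots,k\}$. In each step, independently of the past, a uniformly random vertex $v$ and then a uniformly random neighbour $w$ of $v$ are chosen, and $X_v$ is replaced by $X_v+1$ if $X_v<X_w$, by $X_v-1$ if $X_v>X_w$, and is unchanged if $X_v=X_w$; all other opinions are unchanged. An opinion wins if at some step all vertices hold it. Suppose that $\lambda k=o(1)$, $k=o(n/\log n)$ and $\pi_{\min}=\Theta(1/n)$. Let $c=\sum_v\pi_vX_v(0)$ be the initial degree-weighted average opinion, and let $i$ be the integer with $i\le c<i+1$. Let $p$ and $q$ be the probabilities that $i$, respectively $i+1$, wins. Then with probability $1-o(1)$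 the winning opinion is $i$ or $i+1$, and $$p=i+1-c+o(1),\qquad q=c-i+o(1).$$ In particular, $p\sim i+1-c$ whenever $i+1-c$ is bounded away from $0$, and $q\sim c-i$ whenever $c-i$ is bounded away from $0$. -/

import Mathlib

open Filter Topology Asymptotics MeasureTheory

namespace IncrementalVoting

open scoped Classical in
/-- The transition matrix of the simple random walk: `P(v,u) = 1_{v ~ u} / d(v)`. -/
noncomputable def walkMatrix {V : Type*} [Fintype V] (G : SimpleGraph V) : Matrix V V ℝ :=
  Matrix.of fun v u => if G.Adj v u then 1 / (G.degree v : ℝ) else 0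

open scoped Classical in
/-- The stationary distribution `π_v = d(v) / 2m`, with `m` the number of edges. -/
noncomputable def stationary {V : Type*} [Fintype V] (G : SimpleGraph V) (v : V) : ℝ :=
  (G.degree v : ℝ) / (2 * (G.edgeFinset.card : ℝ))

/-- `π_min`, the smallest stationary probability of a vertex. -/
noncomputable def stationaryMin {V : Type*} [Fintype V] (G : SimpleGraph V) : ℝ :=
  ⨅ v, stationary G v

open scoped Classical in
/-- The second largest eigenvalue in absolute value of the walk matrix: list all eigenvalues with
multiplicity, remove one copy of the top eigenvalue `1`, and take the largest absolute value of
the remaining ones. -/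
noncomputable def secondEigenvalue {V : Type*} [Fintype V] (G : SimpleGraph V) : ℝ :=
  (((walkMatrix G).charpoly.roots.erase 1).map fun μ => ‖μ‖₊).sup

open scoped Classical in
/-- The random choice of the asynchronous vertex process: a uniformly random vertex `v` and then a
uniformly random neighbour `w` of `v`. (An isolated vertex would choose itself, which changes
nothing; connected graphs on at least two vertices have none.) -/
noncomputable def choice {V : Type*} [Fintype V] [Nonempty V] (G : SimpleGraph V) : PMF (V × V) :=
  (PMF.uniformOfFintype V).bind fun v =>
    if h : (G.neighborFinset v).Nonempty then
      (PMF.uniformOfFinset (G.neighborFinset v) h).map fun w => (v, w)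
    else PMF.pure (v, v)

open scoped Classical in
/-- The update of the opinions `x` when `v` chooses `w`: the opinion of `v` moves by one towards
the opinion of `w`, all others stay. -/
noncomputable def update {V : Type*} (x : V → ℤ) (v w : V) : V → ℤ :=
  Function.update x v
    (if x v < x w then x v + 1 else if x w < x v then x v - 1 else x v)

/-- The opinions after `t` steps, started from `x`, when the successive choices are `ω`. -/
noncomputable def opinions {V : Type*} (x : V → ℤ) (ω : ℕ → V × V) : ℕ → V → ℤ
  | 0 => x
  | t + 1 => update (opinions x ω t) (ω t).1 (ω t).2

/-- The event that the opinion `a` wins: at some step all vertices hold `a` (and then they hold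
it forever). -/
def Wins {V : Type*} (x : V → ℤ) (a : ℤ) : Set (ℕ → V × V) :=
  {ω | ∃ t, ∀ v, opinions x ω t v = a}

/-- The probability of an event of the asynchronous vertex process on `G`: the choices made in
the successive steps are independent, each distributed as `choice G`. -/
noncomputable def prob {V : Type*} [Fintype V] [Nonempty V] (G : SimpleGraph V)
    (A : Set (ℕ → V × V)) : ℝ :=
  letI : MeasurableSpace (V × V) := ⊤
  (Measure.infinitePi fun _ : ℕ => (choice G).toMeasure).real A

/-- The degree-weighted average `∑ π_v x_v` of the opinions `x`. -/
noncomputable def weightedAverage {V : Type*} [Fintype V] (G : SimpleGraph V) (x : V → ℤ) : ℝ :=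
  ∑ v, stationary G v * (x v : ℝ)

end IncrementalVoting

/-! Let `Q(v,w) = π_v P(v,w)`, which is symmetric. When `v` looks at `w`, its move is the negative
of the move of `w` looking at `v`, so the weighted average `c(t)` is a martingale. The same
symmetrisation shows that `Γ = ∑ π_v (X_v - i)(X_v - i - 1)` (`spread`) is a supermartingale with
drift `-(1/n) ∑ Q(v,w) max(|X_v - X_w| - 1, 0)`. It is nonnegative and vanishes exactly on opinions
in `{i, i+1}`.

The probability of non-consensus tends to `0`. At consensus on `z`, the indicator of `z = i` differs
from the linear function `i + 1 - z` by at most `(z-i)(z-i-1)`, the value of `Γ`. Hence `|p -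
(i+1-c)| ≤ E Γ(T)` for every `T` (`abs_prob_wins_sub_le`), likewise for `q`, and it suffices to find
one time `T` with `E Γ(T)` small.

For that, `Γ` must contract. Mixing replaces `Q` by `π ⊗ π` in the drift at a cost of `λ²k`
(`dissipation_lower_bound`). For independent vertices the drift is at least `1/k` times the mean of
`d² - |d|` (`pairSpread`). Integrality gives `Γ ≤ ε + (8/ε) pairSpread + (34/ε) e²`, with `e` the
displacement of the mean (`spread_le`). So `Γ` decays at rate `ε/(16kn)` up to small errors, and
about `kn log k / ε` steps suffice, up to an `ε`-dependent factor. Over that time the mean has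
variance at most `T ∑ π_v² / n`, of order `k log k ∑ π_v²`. Mixing also bounds `∑ π_v²` by `λ² + 2/n
+ 2λ/√n` (`IsMixing.sum_sq_le`), so this is `o(1)` when `λk → 0` and `k log n / n → 0`. -/

namespace IncrementalVoting

open scoped Classical

/-! ### Spectral bound and mixing edge measures -/

open Matrix in
/-- Orthogonally to an eigenvector with eigenvalue `1`, a symmetric matrix is bounded by its
largest eigenvalue in absolute value once one copy of `1` is removed. -/
theorem dotProduct_mulVec_sq_le {V : Type*} [Fintype V] (A : Matrix V V ℝ) (hA : A.IsHermitian)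
    (ψ : V → ℝ) (hψ : A *ᵥ ψ = ψ) (hψ0 : ψ ≠ 0) (f g : V → ℝ) (hf : f ⬝ᵥ ψ = 0) :
    (f ⬝ᵥ A *ᵥ g) ^ 2 ≤
      (((A.charpoly.roots.erase 1).map fun μ => ‖μ‖₊).sup : ℝ) ^ 2 * ((f ⬝ᵥ f) * (g ⬝ᵥ g)) := by
  set lam := ((A.charpoly.roots.erase 1).map fun μ => ‖μ‖₊).sup with hlam
  have hroots := hA.roots_charpoly_eq_eigenvalues
  set b := hA.eigenvectorBasis with hb
  set ev := hA.eigenvalues with hev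
  have inner_eq : ∀ x y : V → ℝ, inner ℝ (WithLp.toLp 2 x : EuclideanSpace ℝ V)
      (WithLp.toLp 2 y) = x ⬝ᵥ y := by
    intro x y
    rw [EuclideanSpace.inner_eq_star_dotProduct]
    simp [dotProduct_comm]
  have hsymm : ∀ x y : V → ℝ, x ⬝ᵥ A *ᵥ y = (A *ᵥ x) ⬝ᵥ y := by
    intro x y
    rw [dotProduct_mulVec, ← mulVec_transpose]
    congr 2
  have hAb : ∀ i (y : V → ℝ), (b i).ofLp ⬝ᵥ A *ᵥ y = ev i * ((b i).ofLp ⬝ᵥ y) := by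
    intro i y
    rw [hsymm, hA.mulVec_eigenvectorBasis i, smul_dotProduct, smul_eq_mul]
  have expand : ∀ x y : V → ℝ, x ⬝ᵥ y = ∑ i, (x ⬝ᵥ (b i).ofLp) * ((b i).ofLp ⬝ᵥ y) := by
    intro x y
    rw [← inner_eq, ← b.sum_inner_mul_inner]
    refine Finset.sum_congr rfl fun i _ => ?_
    rw [← inner_eq, ← inner_eq]
  -- An eigenvalue that survives the erasure is bounded by `lam`. Otherwise it is the single
  -- eigenvalue `1`; its eigenspace is then spanned by `ψ`, to which `f` is orthogonal.
  have key : ∀ i, |ev i| ≤ lam ∨ f ⬝ᵥ (b i).ofLp = 0 := by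
    intro i
    by_cases hi : ev i ∈ A.charpoly.roots.erase 1
    · left
      have : ‖ev i‖₊ ≤ lam := Multiset.le_sup (Multiset.mem_map_of_mem _ hi)
      exact_mod_cast this
    · right
      have hmem : ev i ∈ A.charpoly.roots := by
        rw [hroots]
        exact Multiset.mem_map.2 ⟨i, Finset.mem_univ _, by simp [hev]⟩
      have hi1 : ev i = 1 := by
        by_contra hne
        exact hi ((Multiset.mem_erase_of_ne hne).2 hmem)
      -- A second index with eigenvalue `1` would leave a copy of `1` in the multiset after one is
      -- erased.
      have hother : ∀ j, j ≠ i → ev j ≠ 1 := by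
        intro j hj hj1
        apply hi
        rw [hi1, ← Multiset.count_pos, Multiset.count_erase_self, hroots, Multiset.count_map]
        have h2 : ({i, j} : Finset V) ⊆ Finset.univ.filter fun a => (1:ℝ) = ev a := by
          intro a ha
          simp only [Finset.mem_insert, Finset.mem_singleton] at ha
          rcases ha with rfl | rfl <;> simp [hi1, hj1]
        have h3 := Finset.card_le_card h2
        rw [Finset.card_pair hj.symm] at h3
        have h4 : (Multiset.filter (fun a => (1:ℝ) = (RCLike.ofReal ∘ ev) a)
          (Finset.univ : Finset V).val).card
            = (Finset.univ.filter fun a => (1:ℝ) = ev a).card := by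
          simp [Finset.card_def, Finset.filter_val]
        rw [h4]
        omega
      have horth : ∀ j, j ≠ i → (b j).ofLp ⬝ᵥ ψ = 0 := by
        intro j hj
        have := hAb j ψ
        rw [hψ] at this
        have h1 : (1 - ev j) * ((b j).ofLp ⬝ᵥ ψ) = 0 := by linarith
        rcases mul_eq_zero.1 h1 with h | h
        · exact absurd (by linarith) (hother j hj)
        · exact h
      have hfψ := expand f ψ
      rw [hf, Finset.sum_eq_single i (fun j _ hj => by rw [horth j hj, mul_zero])
        (by simp)] at hfψ
      rcases mul_eq_zero.1 hfψ.symm with h | h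
      · exact h
      · exfalso
        apply hψ0
        have : ψ ⬝ᵥ ψ = 0 := by
          rw [expand, Finset.sum_eq_zero]
          intro j _
          by_cases hj : j = i
          · rw [hj, h, mul_zero]
          · rw [horth j hj, mul_zero]
        exact dotProduct_self_eq_zero.1 this
  have h1 : f ⬝ᵥ A *ᵥ g = ∑ i, (f ⬝ᵥ (b i).ofLp) * (ev i * ((b i).ofLp ⬝ᵥ g)) := by
    rw [expand]
    simp_rw [hAb]
  have h2 : f ⬝ᵥ A *ᵥ g = ∑ i, (f ⬝ᵥ (b i).ofLp * ev i) * ((b i).ofLp ⬝ᵥ g) := by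
    rw [h1]
    exact Finset.sum_congr rfl fun i _ => by ring
  have hff : f ⬝ᵥ f = ∑ i, (f ⬝ᵥ (b i).ofLp) ^ 2 := by
    rw [expand]
    exact Finset.sum_congr rfl fun i _ => by rw [dotProduct_comm (b i).ofLp f]; ring
  have hgg : g ⬝ᵥ g = ∑ i, ((b i).ofLp ⬝ᵥ g) ^ 2 := by
    rw [expand]
    exact Finset.sum_congr rfl fun i _ => by rw [dotProduct_comm g]; ring
  rw [h2, hff, hgg, ← mul_assoc, Finset.mul_sum _ _ ((lam : ℝ) ^ 2)]
  refine (Finset.sum_mul_sq_le_sq_mul_sq _ _ _).trans ?_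
  refine mul_le_mul_of_nonneg_right (Finset.sum_le_sum fun i _ => ?_)
    (Finset.sum_nonneg fun i _ => sq_nonneg _)
  rw [mul_pow, mul_comm]
  rcases key i with h | h
  · gcongr 1
    rw [← sq_abs]
    gcongr
  · simp [h]

/-- A symmetric edge measure `Q` with marginal the probability `π`, whose deviation from the
product `π ⊗ π` has operator norm at most `lam`. -/
structure IsMixing {V : Type*} [Fintype V] (π : V → ℝ) (Q : V → V → ℝ) (lam : ℝ) : Prop where
  nonneg : ∀ v w, 0 ≤ Q v w
  symm : ∀ v w, Q v w = Q w v
  sum_right : ∀ v, ∑ w, Q v w = π v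
  sum_one : ∑ v, π v = 1
  lam_nonneg : 0 ≤ lam
  mixing : ∀ f g : V → ℝ, (∑ v, ∑ w, Q v w * (f v * g w) - (∑ v, π v * f v) * ∑ v, π v * g v) ^ 2
    ≤ lam ^ 2 * ((∑ v, π v * f v ^ 2 - (∑ v, π v * f v) ^ 2) *
      (∑ v, π v * g v ^ 2 - (∑ v, π v * g v) ^ 2))

/-- The stationary probability of the ordered pair `(v, w)` under one walk step. -/
noncomputable def edgeMeasure {V : Type*} [Fintype V] (G : SimpleGraph V) (v w : V) : ℝ :=
  if G.Adj v w then 1 / (2 * (G.edgeFinset.card : ℝ)) else 0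

/-! ### The random walk on a connected graph is mixing -/

section Graph

variable {V : Type*} [Fintype V] {G : SimpleGraph V}

theorem degree_pos_of_connected (hG : G.Connected) (hV : 2 ≤ Fintype.card V) (v : V) :
    0 < G.degree v := by
  have : Nontrivial V := Fintype.one_lt_card_iff_nontrivial.1 hV
  exact hG.preconnected.degree_pos_of_nontrivial v

theorem card_edgeFinset_pos (hG : G.Connected) (hV : 2 ≤ Fintype.card V) :
    0 < G.edgeFinset.card := by
  obtain ⟨v⟩ := hG.nonempty
  have h := G.sum_degrees_eq_twice_card_edges
  have := Finset.single_le_sum (f := fun v => G.degree v) (fun _ _ => Nat.zero_le _)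
    (Finset.mem_univ v)
  have := degree_pos_of_connected hG hV v
  omega

theorem sum_adj (v : V) (r : ℝ) : ∑ w, (if G.Adj v w then r else 0) = G.degree v * r := by
  rw [← Finset.sum_filter, Finset.sum_const, nsmul_eq_mul, ← SimpleGraph.neighborFinset_eq_filter,
    SimpleGraph.card_neighborFinset_eq_degree]

theorem sum_edgeMeasure (v : V) : ∑ w, edgeMeasure G v w = stationary G v := by
  simp only [edgeMeasure, sum_adj, stationary]
  ring

theorem edgeMeasure_comm (v w : V) : edgeMeasure G v w = edgeMeasure G w v := by
  simp only [edgeMeasure, G.adj_comm]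

theorem edgeMeasure_nonneg (v w : V) : 0 ≤ edgeMeasure G v w := by
  unfold edgeMeasure
  split_ifs <;> positivity

theorem sum_stationary (hG : G.Connected) (hV : 2 ≤ Fintype.card V) :
    ∑ v, stationary G v = 1 := by
  have hm : (0:ℝ) < G.edgeFinset.card := by exact_mod_cast card_edgeFinset_pos hG hV
  have h : (∑ v, (G.degree v : ℝ)) = 2 * G.edgeFinset.card := by
    exact_mod_cast G.sum_degrees_eq_twice_card_edges
  simp only [stationary]
  rw [← Finset.sum_div, h, div_self (by positivity)]

theorem stationary_pos (hG : G.Connected) (hV : 2 ≤ Fintype.card V) (v : V) :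
    0 < stationary G v := by
  have hm : (0:ℝ) < G.edgeFinset.card := by exact_mod_cast card_edgeFinset_pos hG hV
  have hd : (0:ℝ) < G.degree v := by exact_mod_cast degree_pos_of_connected hG hV v
  unfold stationary
  positivity

theorem stationary_mul_walkMatrix (hG : G.Connected) (hV : 2 ≤ Fintype.card V) (v w : V) :
    stationary G v * walkMatrix G v w = edgeMeasure G v w := by
  have hd : (0:ℝ) < G.degree v := by exact_mod_cast degree_pos_of_connected hG hV v
  simp only [stationary, walkMatrix, edgeMeasure, Matrix.of_apply]
  split_ifs
  · field_simp
  · simp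

theorem sum_walkMatrix (hG : G.Connected) (hV : 2 ≤ Fintype.card V) (v : V) :
    ∑ w, walkMatrix G v w = 1 := by
  have hd : (0:ℝ) < G.degree v := by exact_mod_cast degree_pos_of_connected hG hV v
  simp only [walkMatrix, Matrix.of_apply, sum_adj]
  field_simp

/-- Conjugating the walk matrix by `√π` gives the symmetric matrix `Q(v,w)/√(π_v π_w)` with the same
characteristic polynomial. It fixes `√π`, and centring `f` makes `√π f` orthogonal to `√π`, so the
spectral bound applies. -/
theorem isMixing_edgeMeasure (hG : G.Connected) (hV : 2 ≤ Fintype.card V) :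
    IsMixing (stationary G) (edgeMeasure G) (secondEigenvalue G) := by
  refine ⟨edgeMeasure_nonneg, edgeMeasure_comm, sum_edgeMeasure, sum_stationary hG hV,
    NNReal.coe_nonneg _, fun f g => ?_⟩
  have hpos := stationary_pos hG hV
  set π := stationary G with hπ
  set s : V → ℝ := fun v => √(π v) with hs
  have hs2 : ∀ v, s v * s v = π v := fun v => Real.mul_self_sqrt (hpos v).le
  have hs0 : ∀ v, 0 < s v := fun v => Real.sqrt_pos.2 (hpos v)
  set A : Matrix V V ℝ := Matrix.of fun v w => edgeMeasure G v w / (s v * s w) with hAdef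
  have hA : A.IsHermitian := by
    ext v w
    simp [hAdef, edgeMeasure_comm v w, mul_comm]
  have hchar : (walkMatrix G).charpoly = A.charpoly := by
    have h1 : walkMatrix G = (Matrix.diagonal fun v => (s v)⁻¹) * (A * Matrix.diagonal s) := by
      ext v w
      rw [Matrix.diagonal_mul, Matrix.mul_diagonal, hAdef, Matrix.of_apply,
        ← stationary_mul_walkMatrix hG hV v w, ← hπ, ← hs2 v]
      have := (hs0 v).ne'
      have := (hs0 w).ne'
      field_simp
    have h2 : A * Matrix.diagonal s * (Matrix.diagonal fun v => (s v)⁻¹) = A := by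
      rw [Matrix.mul_assoc, Matrix.diagonal_mul_diagonal]
      have : (fun i => s i * (s i)⁻¹) = fun _ => (1:ℝ) := by
        funext i
        exact mul_inv_cancel₀ (hs0 i).ne'
      rw [this, Matrix.diagonal_one, Matrix.mul_one]
    rw [h1, Matrix.charpoly_mul_comm, h2]
  have hquad : ∀ a b : V → ℝ, (fun v => s v * a v) ⬝ᵥ A.mulVec (fun v => s v * b v)
      = ∑ v, ∑ w, edgeMeasure G v w * (a v * b w) := by
    intro a b
    simp only [dotProduct, Matrix.mulVec, Finset.mul_sum, hAdef, Matrix.of_apply]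
    refine Finset.sum_congr rfl fun v _ => Finset.sum_congr rfl fun w _ => ?_
    have := (hs0 v).ne'
    have := (hs0 w).ne'
    field_simp
  have hdot : ∀ a b : V → ℝ, (fun v => s v * a v) ⬝ᵥ (fun v => s v * b v)
      = ∑ v, π v * (a v * b v) := by
    intro a b
    simp only [dotProduct]
    refine Finset.sum_congr rfl fun v _ => ?_
    rw [← hs2 v]
    ring
  have hsψ : A.mulVec s = s := by
    funext v
    simp only [Matrix.mulVec, dotProduct, hAdef, Matrix.of_apply]
    have : ∀ w, edgeMeasure G v w / (s v * s w) * s w = edgeMeasure G v w / s v := by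
      intro w
      have := (hs0 v).ne'
      have := (hs0 w).ne'
      field_simp
    simp_rw [this]
    rw [← Finset.sum_div, sum_edgeMeasure, ← hπ, ← hs2 v]
    have := (hs0 v).ne'
    field_simp
  have hs_ne : s ≠ 0 := by
    obtain ⟨v⟩ := hG.nonempty
    intro h
    exact (hs0 v).ne' (congrFun h v)
  have hsum1 : ∑ v, π v = 1 := sum_stationary hG hV
  set cf := ∑ v, π v * f v with hcf
  set cg := ∑ v, π v * g v with hcg
  have horth : (fun v => s v * (f v - cf)) ⬝ᵥ s = 0 := by
    have := hdot (fun v => f v - cf) (fun _ => 1)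
    simp only [mul_one] at this
    rw [show (fun v => s v) = s from rfl] at this
    rw [this]
    simp only [mul_sub, Finset.sum_sub_distrib, ← Finset.sum_mul, hsum1, ← hcf]
    ring
  have hmain := dotProduct_mulVec_sq_le A hA s hsψ hs_ne (fun v => s v * (f v - cf))
    (fun v => s v * (g v - cg)) horth
  have hvar : ∀ (h : V → ℝ) , ∑ v, π v * ((h v - ∑ v, π v * h v) * (h v - ∑ v, π v * h v))
      = ∑ v, π v * h v ^ 2 - (∑ v, π v * h v) ^ 2 := by
    intro h
    set c := ∑ v, π v * h v with hc
    have : ∀ v, π v * ((h v - c) * (h v - c)) = π v * h v ^ 2 - 2 * c * (π v * h v)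
        + c ^ 2 * π v := fun v => by ring
    simp_rw [this]
    rw [Finset.sum_add_distrib, Finset.sum_sub_distrib, ← Finset.mul_sum, ← Finset.mul_sum, hsum1,
      ← hc]
    ring
  have hcross : ∑ v, ∑ w, edgeMeasure G v w * ((f v - cf) * (g w - cg))
      = ∑ v, ∑ w, edgeMeasure G v w * (f v * g w) - cf * cg := by
    have e1 : ∀ v w, edgeMeasure G v w * ((f v - cf) * (g w - cg))
        = edgeMeasure G v w * (f v * g w) - edgeMeasure G v w * f v * cg
          - edgeMeasure G v w * g w * cf + edgeMeasure G v w * (cf * cg) := fun v w => by ring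
    have e2 : ∑ v, ∑ w, edgeMeasure G v w * g w * cf = cf * cg := by
      rw [Finset.sum_comm]
      simp_rw [← Finset.sum_mul, edgeMeasure_comm, sum_edgeMeasure]
      rw [← hπ, ← hcg]
      ring
    have e3 : ∑ v, ∑ w, edgeMeasure G v w * f v * cg = cf * cg := by
      simp_rw [← Finset.sum_mul, sum_edgeMeasure]
      rw [← hπ, ← hcf]
    have e4 : ∑ v, ∑ w, edgeMeasure G v w * (cf * cg) = cf * cg := by
      simp_rw [← Finset.sum_mul, sum_edgeMeasure]
      rw [← hπ, hsum1]
      ring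
    simp_rw [e1, Finset.sum_add_distrib, Finset.sum_sub_distrib]
    rw [e2, e3, e4]
    ring
  rw [hquad, hdot, hdot, hvar, hvar, hcross, ← hchar] at hmain
  exact hmain

end Graph

/-! ### Consequences of mixing: size of `π`, and comparison of `Q` with `π ⊗ π` -/

section Mixing

variable {V : Type*} [Fintype V] {π : V → ℝ} {Q : V → V → ℝ} {lam : ℝ}

theorem IsMixing.prob_nonneg (h : IsMixing π Q lam) (v : V) : 0 ≤ π v := by
  rw [← h.sum_right]
  exact Finset.sum_nonneg fun w _ => h.nonneg v w

theorem IsMixing.sum_left (h : IsMixing π Q lam) (w : V) : ∑ v, Q v w = π w := by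
  rw [← h.sum_right]
  exact Finset.sum_congr rfl fun v _ => h.symm v w

/-- Test mixing on the indicator of `v` twice: without loops the edge term vanishes, which leaves
`π_v² ≤ lam (π_v - π_v²)`. -/
theorem IsMixing.prob_le (h : IsMixing π Q lam) (hQ : ∀ v, Q v v = 0) (v : V) : π v ≤ lam := by
  have hm := h.mixing (fun u => if u = v then 1 else 0) (fun u => if u = v then 1 else 0)
  simp only [mul_ite, mul_one, mul_zero, ite_pow, one_pow, zero_pow two_ne_zero,
    Finset.sum_ite_eq', Finset.mem_univ, if_true, hQ, zero_sub] at hm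
  have h0 := h.prob_nonneg v
  have hl := h.lam_nonneg
  by_contra! hlt
  have hpos : 0 < π v := lt_of_le_of_lt hl hlt
  have h1 : lam ^ 2 * ((π v - π v ^ 2) * (π v - π v ^ 2)) ≤ lam ^ 2 * (π v * π v) := by
    have hle : π v ≤ 1 := by
      rw [← h.sum_one]
      exact Finset.single_le_sum (fun u _ => h.prob_nonneg u) (Finset.mem_univ v)
    have : 0 ≤ π v - π v ^ 2 := by nlinarith
    have : π v - π v ^ 2 ≤ π v := by nlinarith
    gcongr
  have h2 : (π v * π v) ^ 2 ≤ (lam * π v) ^ 2 := by nlinarith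
  have h3 := abs_le_of_sq_le_sq' h2 (by positivity)
  nlinarith [h3.2]

/-- Test mixing on `f = g = π`. The edge term is at most `R`, and the variance of `π` is at most `∑
π_v³ ≤ lam ∑ π_v²`. -/
theorem IsMixing.sum_sq_sq_le (h : IsMixing π Q lam) (hQ : ∀ v, Q v v = 0) {R : ℝ}
    (hR : ∀ v w, Q v w ≤ R) :
    (∑ v, π v ^ 2) ^ 2 ≤ lam ^ 2 * ∑ v, π v ^ 2 + R := by
  have hm := h.mixing π π
  have hl := h.lam_nonneg
  set S := ∑ v, π v ^ 2 with hS
  have hS' : ∑ v, π v * π v = S := Finset.sum_congr rfl fun v _ => (sq (π v)).symm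
  have hS0 : 0 ≤ S := Finset.sum_nonneg fun v _ => sq_nonneg _
  have h3 : ∑ v, π v * π v ^ 2 ≤ lam * S := by
    rw [hS, Finset.mul_sum]
    exact Finset.sum_le_sum fun v _ => mul_le_mul_of_nonneg_right (h.prob_le hQ v) (sq_nonneg _)
  have hQR : ∑ v, ∑ w, Q v w * (π v * π w) ≤ R := by
    calc ∑ v, ∑ w, Q v w * (π v * π w) ≤ ∑ v, ∑ w, R * (π v * π w) :=
          Finset.sum_le_sum fun v _ => Finset.sum_le_sum fun w _ =>
            mul_le_mul_of_nonneg_right (hR v w) (mul_nonneg (h.prob_nonneg v) (h.prob_nonneg w))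
      _ = R * ((∑ v, π v) * ∑ w, π w) := by
          rw [Finset.sum_mul_sum, Finset.mul_sum]
          exact Finset.sum_congr rfl fun v _ => by rw [Finset.mul_sum]
      _ = R := by rw [h.sum_one]; ring
  set T := ∑ v, π v * π v ^ 2 with hT
  set B := ∑ v, ∑ w, Q v w * (π v * π w) with hB
  rw [hS'] at hm
  have hTS : 0 ≤ T - S ^ 2 := by
    have : T - S ^ 2 = ∑ v, π v * (π v - S) ^ 2 := by
      have e : ∀ v, π v * (π v - S) ^ 2 = π v * π v ^ 2 - 2 * S * (π v * π v) + S ^ 2 * π v :=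
        fun v => by ring
      simp_rw [e, Finset.sum_add_distrib, Finset.sum_sub_distrib, ← Finset.mul_sum]
      rw [h.sum_one, hS', ← hT]
      ring
    rw [this]
    exact Finset.sum_nonneg fun v _ => mul_nonneg (h.prob_nonneg v) (sq_nonneg _)
  have h4 : (B - S * S) ^ 2 ≤ (lam * (T - S ^ 2)) ^ 2 := by nlinarith
  have h5 := abs_le_of_sq_le_sq' h4 (by positivity)
  nlinarith [h5.1]

/-- Counting the return probabilities after two steps. -/
theorem IsMixing.card_mul_le (h : IsMixing π Q lam) (hpos : ∀ v, 0 < π v) {R : ℝ}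
    (hR : ∀ v w, Q v w = 0 ∨ Q v w = R) :
    Fintype.card V * R ≤ lam ^ 2 + ∑ v, π v ^ 2 := by
  have hv : ∀ v, ∑ u, R * (Q v u / π u) ≤ lam ^ 2 * π v + π v ^ 2 := by
    intro v
    -- The sum `X` below is `π_v` times the return probability to `v` after two steps. The
    -- covariance of this pair and the variance of the second function both equal `X - π_v²`, so one
    -- factor cancels.
    have hm := h.mixing (fun u => if u = v then 1 else 0) (fun u => Q v u / π u)
    have e0 : ∀ u, π u * (Q v u / π u) = Q v u := fun u => mul_div_cancel₀ _ (hpos u).ne'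
    have e1 : ∀ u, π u * (Q v u / π u) ^ 2 = R * (Q v u / π u) := by
      intro u
      have := (hpos u).ne'
      rcases hR v u with h0 | h0
      · simp [h0]
      · rw [h0]; field_simp
    have e2 : ∀ u, Q v u * (Q v u / π u) = R * (Q v u / π u) := by
      intro u
      rcases hR v u with h0 | h0 <;> simp [h0]
    have e3 : ∑ u, ∑ w, Q u w * ((if u = v then 1 else 0) * (Q v w / π w))
        = ∑ w, Q v w * (Q v w / π w) := by
      rw [Finset.sum_eq_single v (fun u _ hu => by simp [hu]) (by simp)]
      simp
    rw [e3] at hm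
    simp only [mul_ite, mul_one, mul_zero, ite_pow, one_pow, zero_pow two_ne_zero,
      Finset.sum_ite_eq', Finset.mem_univ, if_true, e0, e1, e2, h.sum_right] at hm
    set X := ∑ u, R * (Q v u / π u)
    by_contra! hlt
    have hp := hpos v
    have h1 : 0 < X - π v ^ 2 := by nlinarith [sq_nonneg lam]
    have h2 : (X - π v ^ 2) * (X - π v ^ 2) ≤ lam ^ 2 * π v * (X - π v ^ 2) := by
      have : lam ^ 2 * ((π v - π v ^ 2) * (X - π v ^ 2)) ≤ lam ^ 2 * (π v * (X - π v ^ 2)) := by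
        have := mul_nonneg (sq_nonneg lam) (mul_nonneg (sq_nonneg (π v)) h1.le)
        nlinarith
      nlinarith
    have := le_of_mul_le_mul_right h2 h1
    linarith
  have hsum := Finset.sum_le_sum fun v (_ : v ∈ Finset.univ) => hv v
  rw [Finset.sum_comm, Finset.sum_add_distrib, ← Finset.mul_sum, h.sum_one, mul_one] at hsum
  have e : ∀ u, ∑ v, R * (Q v u / π u) = R := by
    intro u
    rw [← Finset.mul_sum, ← Finset.sum_div, h.sum_left, div_self (hpos u).ne', mul_one]
  simp_rw [e] at hsum
  simpa using hsum

/-- The stationary distribution is nearly uniform in `ℓ²` under good mixing. -/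
theorem IsMixing.sum_sq_le (h : IsMixing π Q lam) (hQ : ∀ v, Q v v = 0) (hpos : ∀ v, 0 < π v)
    {R : ℝ} (hR : ∀ v w, Q v w = 0 ∨ Q v w = R) (hR0 : 0 ≤ R) (hV : 0 < Fintype.card V) :
    ∑ v, π v ^ 2 ≤ lam ^ 2 + 2 / (Fintype.card V : ℝ) + 2 * lam / √(Fintype.card V : ℝ) := by
  have h1 := h.sum_sq_sq_le hQ (R := R) fun v w => by rcases hR v w with h | h <;> rw [h]; exact hR0
  have h2 := h.card_mul_le hpos hR
  have hl := h.lam_nonneg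
  have hn : (0:ℝ) < Fintype.card V := by exact_mod_cast hV
  set n : ℝ := (Fintype.card V : ℝ)
  set S := ∑ v, π v ^ 2
  set r := √R with hr
  have hr0 : 0 ≤ r := Real.sqrt_nonneg _
  have hrR : R = r ^ 2 := (Real.sq_sqrt hR0).symm
  have hs0 : 0 < √n := Real.sqrt_pos.2 hn
  have hsn : √n ^ 2 = n := Real.sq_sqrt hn.le
  -- This solves the quadratic inequality `S² ≤ lam² S + r²`.
  have hS : S ≤ lam ^ 2 + r := by
    by_contra! hlt
    have : 0 ≤ lam ^ 2 := sq_nonneg _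
    nlinarith
  -- Counting gives `n r² ≤ 2 lam² + r`. If `r > 2/n`, then `r` is less than half of the left side
  -- and is absorbed.
  have hr2 : r ≤ 2 / n + 2 * lam / √n := by
    by_cases hc : r ≤ 2 / n
    · have : 0 ≤ 2 * lam / √n := by positivity
      linarith
    · push Not at hc
      rw [div_lt_iff₀ hn] at hc
      have h3 : n * r ^ 2 ≤ (2 * lam) ^ 2 := by nlinarith
      have h4 : (r * √n) ^ 2 ≤ (2 * lam) ^ 2 := by rw [mul_pow, hsn]; linarith
      have h5 := (abs_le_of_sq_le_sq' h4 (by positivity)).2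
      have : r ≤ 2 * lam / √n := by rwa [le_div_iff₀ hs0]
      have : 0 ≤ 2 / n := by positivity
      linarith
  linarith

/-- The mixing error `lam √(ab)`, for sets of measure `a` and `b`, is at most `(ab + lam²)/2` by
AM-GM. Giving up half the main term leaves an error independent of the sets. -/
theorem IsMixing.indicator_lower_bound (h : IsMixing π Q lam) (f g : V → ℝ)
    (hf : ∀ v, f v ^ 2 = f v) (hg : ∀ v, g v ^ 2 = g v) :
    (∑ v, π v * f v) * (∑ v, π v * g v) / 2 - lam ^ 2 / 2 ≤ ∑ v, ∑ w, Q v w * (f v * g w) := by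
  have hm := h.mixing f g
  simp only [hf, hg] at hm
  have hrange : ∀ f : V → ℝ, (∀ v, f v ^ 2 = f v) →
      0 ≤ ∑ v, π v * f v ∧ ∑ v, π v * f v ≤ 1 := by
    intro f hf
    refine ⟨Finset.sum_nonneg fun v _ => mul_nonneg (h.prob_nonneg v) ?_, ?_⟩
    · rw [← hf]; positivity
    · rw [← h.sum_one]
      refine Finset.sum_le_sum fun v _ => mul_le_of_le_one_right (h.prob_nonneg v) ?_
      nlinarith [hf v, sq_nonneg (f v - 1)]
  obtain ⟨ha0, ha1⟩ := hrange f hf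
  obtain ⟨hb0, hb1⟩ := hrange g hg
  set a := ∑ v, π v * f v
  set b := ∑ v, π v * g v
  set X := ∑ v, ∑ w, Q v w * (f v * g w)
  have h1 : (a - a ^ 2) * (b - b ^ 2) ≤ a * b := by
    have : 0 ≤ b - b ^ 2 := by nlinarith
    apply mul_le_mul <;> nlinarith
  have h2 : (X - a * b) ^ 2 ≤ ((a * b + lam ^ 2) / 2) ^ 2 := by
    have := mul_le_mul_of_nonneg_left h1 (sq_nonneg lam)
    nlinarith [sq_nonneg (a * b - lam ^ 2)]
  have h3 := abs_le_of_sq_le_sq' h2 (by positivity)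
  linarith [h3.1]

/-- The excess counts the integers strictly between `a` and `b`. This reduces the drift to products
of threshold indicators, to which mixing applies. -/
theorem max_abs_sub_one_eq_sum {k : ℕ} {a b : ℤ} (ha : 1 ≤ a ∧ a ≤ k) (hb : 1 ≤ b ∧ b ≤ k) :
    max (|(a : ℝ) - b| - 1) 0 = ∑ z ∈ Finset.Icc (1 : ℤ) k,
      ((if a < z then 1 else 0) * (if z < b then 1 else 0)
        + (if b < z then 1 else 0) * (if z < a then 1 else 0)) := by
  have hcount : ∀ a b : ℤ, 1 ≤ a → b ≤ k → ∑ z ∈ Finset.Icc (1 : ℤ) k,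
      ((if a < z then 1 else 0) * (if z < b then 1 else 0) : ℝ) = ((b - a - 1).toNat : ℝ) := by
    intro a b ha hb
    have : ∀ z : ℤ, ((if a < z then 1 else 0) * (if z < b then 1 else 0) : ℝ)
        = if a < z ∧ z < b then 1 else 0 := by
      intro z
      split_ifs <;> simp_all
    simp_rw [this]
    rw [← Finset.sum_filter, Finset.sum_const, nsmul_eq_mul, mul_one]
    have hfil : (Finset.Icc (1 : ℤ) k).filter (fun z => a < z ∧ z < b) = Finset.Ioo a b := by
      ext z
      simp only [Finset.mem_filter, Finset.mem_Icc, Finset.mem_Ioo]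
      omega
    rw [hfil, Int.card_Ioo]
  rw [Finset.sum_add_distrib, hcount a b ha.1 hb.2, hcount b a hb.1 ha.2]
  have hcast : max (|(a : ℝ) - b| - 1) 0 = ((max (|a - b| - 1) 0 : ℤ) : ℝ) := by push_cast; rfl
  have hnat : ((b - a - 1).toNat : ℝ) + ((a - b - 1).toNat : ℝ)
      = ((((b - a - 1).toNat + (a - b - 1).toNat : ℕ) : ℤ) : ℝ) := by push_cast; rfl
  rw [hcast, hnat]
  congr 1
  push_cast
  rcases abs_cases (a - b) with ⟨h, _⟩ | ⟨h, _⟩ <;> omega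

/-- Along edges, opinions differ by more than one nearly as much as for independent vertices. -/
theorem IsMixing.dissipation_lower_bound (h : IsMixing π Q lam) {k : ℕ} {x : V → ℤ}
    (hx : ∀ v, 1 ≤ x v ∧ x v ≤ k) :
    (∑ v, ∑ w, π v * π w * max (|(x v : ℝ) - x w| - 1) 0) / 2 - lam ^ 2 * k
      ≤ ∑ v, ∑ w, Q v w * max (|(x v : ℝ) - x w| - 1) 0 := by
  set lo : ℤ → V → ℝ := fun z v => if x v < z then 1 else 0 with hlo
  set up : ℤ → V → ℝ := fun z v => if z < x v then 1 else 0 with hup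
  have hlo2 : ∀ z v, lo z v ^ 2 = lo z v := fun z v => by simp only [hlo]; split_ifs <;> norm_num
  have hup2 : ∀ z v, up z v ^ 2 = up z v := fun z v => by simp only [hup]; split_ifs <;> norm_num
  have hsplit : ∀ K : V → V → ℝ, ∑ v, ∑ w, K v w * max (|(x v : ℝ) - x w| - 1) 0
      = ∑ z ∈ Finset.Icc (1 : ℤ) k, (∑ v, ∑ w, K v w * (lo z v * up z w)
        + ∑ v, ∑ w, K v w * (up z v * lo z w)) := by
    intro K
    have : ∀ v w, K v w * max (|(x v : ℝ) - x w| - 1) 0 = ∑ z ∈ Finset.Icc (1 : ℤ) k,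
        (K v w * (lo z v * up z w) + K v w * (up z v * lo z w)) := by
      intro v w
      rw [max_abs_sub_one_eq_sum (hx v) (hx w), Finset.mul_sum]
      exact Finset.sum_congr rfl fun z _ => by simp only [hlo, hup]; ring
    simp_rw [this]
    simp_rw [← Finset.sum_add_distrib]
    rw [Finset.sum_comm (s := Finset.Icc (1 : ℤ) k)]
    exact Finset.sum_congr rfl fun v _ => Finset.sum_comm
  have hcard : ∑ z ∈ Finset.Icc (1 : ℤ) k, lam ^ 2 = lam ^ 2 * k := by
    rw [Finset.sum_const, Int.card_Icc, nsmul_eq_mul]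
    simp [mul_comm]
  rw [hsplit, hsplit, ← hcard, Finset.sum_div, ← Finset.sum_sub_distrib]
  refine Finset.sum_le_sum fun z _ => ?_
  have hprod : ∀ f g : V → ℝ, ∑ v, ∑ w, π v * π w * (f v * g w)
      = (∑ v, π v * f v) * ∑ v, π v * g v := by
    intro f g
    rw [Finset.sum_mul_sum]
    exact Finset.sum_congr rfl fun v _ => Finset.sum_congr rfl fun w _ => by ring
  -- Each of the `k` thresholds is used in both orders, each costing `lam²/2`; hence the total error
  -- `lam² k`.
  have h1 := h.indicator_lower_bound (lo z) (up z) (hlo2 z) (hup2 z)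
  have h2 := h.indicator_lower_bound (up z) (lo z) (hup2 z) (hlo2 z)
  rw [hprod, hprod]
  linarith

end Mixing

/-! ### Static inequalities for integer opinions -/

section Integers

variable {V : Type*} [Fintype V] {π : V → ℝ} {x : V → ℤ}

/-- The excess second moment of the opinions: it vanishes exactly when all opinions are `i` or
`i + 1`. -/
noncomputable def spread (π : V → ℝ) (i : ℤ) (x : V → ℤ) : ℝ :=
  ∑ v, π v * (((x v : ℝ) - i) * ((x v : ℝ) - i - 1))

/-- The mean of `d² - |d|` for the difference `d` of the opinions of two independent vertices. -/
noncomputable def pairSpread (π : V → ℝ) (x : V → ℤ) : ℝ :=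
  ∑ v, ∑ w, π v * π w * (((x v : ℝ) - x w) ^ 2 - |(x v : ℝ) - x w|)

theorem abs_le_sq_intCast (a b : ℤ) : |(a : ℝ) - b| ≤ ((a : ℝ) - b) ^ 2 := by
  have h : |a - b| ≤ (a - b) ^ 2 := by
    rw [← sq_abs]
    rcases (abs_nonneg (a - b)).eq_or_lt with h | h <;> nlinarith
  exact_mod_cast h

theorem mul_pred_nonneg_intCast (a i : ℤ) : 0 ≤ ((a : ℝ) - i) * ((a : ℝ) - i - 1) := by
  have h : 0 ≤ (a - i) * (a - i - 1) := by
    rcases le_or_gt (a - i) 0 with h | h <;> nlinarith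
  exact_mod_cast h

theorem spread_nonneg (hπ : ∀ v, 0 ≤ π v) (i : ℤ) : 0 ≤ spread π i x :=
  Finset.sum_nonneg fun v _ => mul_nonneg (hπ v) (mul_pred_nonneg_intCast _ _)

theorem pairSpread_nonneg (hπ : ∀ v, 0 ≤ π v) : 0 ≤ pairSpread π x :=
  Finset.sum_nonneg fun v _ => Finset.sum_nonneg fun w _ =>
    mul_nonneg (mul_nonneg (hπ v) (hπ w)) (sub_nonneg.2 (abs_le_sq_intCast _ _))

theorem sq_sub_le_of_le_sub {a b t : ℝ} (ht : 1 ≤ t) (h : t ≤ b - a) :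
    t ^ 2 - t ≤ (a - b) ^ 2 - |a - b| := by
  rw [abs_of_nonpos (by linarith)]
  nlinarith

/-- A product of two means is a mean over two independent vertices; symmetrising in the two vertices
produces the factor `2`. -/
theorem two_mul_mul_le_pairSpread (hπ : ∀ v, 0 ≤ π v) {α β : ℤ → ℝ}
    (h : ∀ a b : ℤ, α a * β b + β a * α b ≤ ((a : ℝ) - b) ^ 2 - |(a : ℝ) - b|) :
    2 * ((∑ v, π v * α (x v)) * ∑ v, π v * β (x v)) ≤ pairSpread π x := by
  have e : 2 * ((∑ v, π v * α (x v)) * ∑ v, π v * β (x v))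
      = ∑ v, ∑ w, π v * π w * (α (x v) * β (x w) + β (x v) * α (x w)) := by
    have h1 := Finset.sum_mul_sum Finset.univ Finset.univ (fun v => π v * α (x v))
      (fun v => π v * β (x v))
    have h2 := Finset.sum_mul_sum Finset.univ Finset.univ (fun v => π v * β (x v))
      (fun v => π v * α (x v))
    rw [two_mul]
    nth_rewrite 2 [mul_comm]
    rw [h1, h2, ← Finset.sum_add_distrib]
    refine Finset.sum_congr rfl fun v _ => ?_
    rw [← Finset.sum_add_distrib]
    exact Finset.sum_congr rfl fun w _ => by ring
  rw [e]
  exact Finset.sum_le_sum fun v _ => Finset.sum_le_sum fun w _ =>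
    mul_le_mul_of_nonneg_left (h _ _) (mul_nonneg (hπ v) (hπ w))

theorem sq_sub_abs_comm (a b : ℝ) : (a - b) ^ 2 - |a - b| = (b - a) ^ 2 - |b - a| := by
  rw [abs_sub_comm]
  ring

theorem two_mul_mul_indicator_le (hπ : ∀ v, 0 ≤ π v) {A B : ℤ → Prop} [DecidablePred A]
    [DecidablePred B] {g : ℤ → ℝ}
    (hAB : ∀ a b : ℤ, A a → B b → g b ≤ ((a : ℝ) - b) ^ 2 - |(a : ℝ) - b|)
    (hdisj : ∀ a, A a → ¬ B a) :
    2 * ((∑ v, π v * (if A (x v) then 1 else 0)) * ∑ v, π v * (if B (x v) then g (x v) else 0))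
      ≤ pairSpread π x := by
  refine two_mul_mul_le_pairSpread (α := fun a => if A a then 1 else 0)
    (β := fun a => if B a then g a else 0) hπ fun a b => ?_
  have h0 : (0:ℝ) ≤ ((a : ℝ) - b) ^ 2 - |(a : ℝ) - b| := sub_nonneg.2 (abs_le_sq_intCast a b)
  have h1 := hAB a b
  have h2 := hAB b a
  rw [sq_sub_abs_comm] at h2
  have h3 := hdisj a
  have h4 := hdisj b
  by_cases hAa : A a <;> by_cases hBb : B b <;> by_cases hAb : A b <;> by_cases hBa : B a <;>
    simp_all

/-- The part of `spread` above `i + 1`. -/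
theorem upper_spread_le (hπ : ∀ v, 0 ≤ π v) (hsum : ∑ v, π v = 1) {i : ℤ} {e ε : ℝ}
    (he : 0 ≤ e) (hc : ∑ v, π v * (x v : ℝ) ≤ i + 1 + e) (hε : 0 < ε) (hε1 : ε ≤ 1)
    (hG : spread π i x ≤ 1 + e + e ^ 2) :
    ∑ v, π v * (if i + 1 < x v then ((x v : ℝ) - i) * ((x v : ℝ) - i - 1) else 0)
      ≤ ε / 4 + 4 / ε * pairSpread π x + 4 * e + e ^ 2 := by
  set g : ℤ → ℝ := fun a => ((a : ℝ) - i) * ((a : ℝ) - i - 1) with hg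
  set H := pairSpread π x with hH
  have hH0 : 0 ≤ H := pairSpread_nonneg hπ
  have hg0 : ∀ a, 0 ≤ g a := fun a => mul_pred_nonneg_intCast a i
  set gp : ℤ → ℝ := fun a => if i + 1 < a then g a else 0 with hgp
  -- With `s = a - i ≥ 3` and an opponent at most `i + 1`, the pair contributes at least `(s-1)(s-2)
  -- ≥ s(s-1)/3`; hence the `1/3`.
  set gpp : ℤ → ℝ := fun a => if i + 2 < a then g a / 3 else 0 with hgpp
  set gm : ℤ → ℝ := fun a => if a < i then g a else 0 with hgm
  set l0 : ℤ → ℝ := fun a => if a ≤ i then 1 else 0 with hl0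
  set l1 : ℤ → ℝ := fun a => if a ≤ i + 1 then 1 else 0 with hl1
  set u1 : ℤ → ℝ := fun a => if i < a then 1 else 0 with hu1
  set F : ℤ → ℝ := fun a => max ((a : ℝ) - i - 1) 0 with hF
  have p1 : 2 * ((∑ v, π v * l0 (x v)) * ∑ v, π v * gp (x v)) ≤ H := by
    refine two_mul_mul_indicator_le (A := fun a => a ≤ i) (B := fun a => i + 1 < a) (g := g) hπ
      (fun a b ha hb => ?_) (fun a (ha : _ ≤ _) (hb : _ < _) => by omega)
    have ha' : (a : ℝ) ≤ i := by exact_mod_cast ha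
    have hb' : (i : ℝ) + 2 ≤ b := by exact_mod_cast (show i + 2 ≤ b by omega)
    have := sq_sub_le_of_le_sub (a := a) (b := b) (t := b - i) (by linarith) (by linarith)
    simp only [hg]
    linarith
  have p2 : 2 * ((∑ v, π v * l1 (x v)) * ∑ v, π v * gpp (x v)) ≤ H := by
    refine two_mul_mul_indicator_le (A := fun a => a ≤ i + 1) (B := fun a => i + 2 < a)
      (g := fun a => g a / 3) hπ (fun a b ha hb => ?_) (fun a (ha : _ ≤ _) (hb : _ < _) => by omega)
    have ha' : (a : ℝ) ≤ i + 1 := by exact_mod_cast ha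
    have hb' : (i : ℝ) + 3 ≤ b := by exact_mod_cast (show i + 3 ≤ b by omega)
    have := sq_sub_le_of_le_sub (a := a) (b := b) (t := b - i - 1) (by linarith) (by linarith)
    have h3 : 0 ≤ ((b : ℝ) - i - 1) * (b - i - 3) := mul_nonneg (by linarith) (by linarith)
    simp only [hg]
    linarith
  have p3 : 2 * ((∑ v, π v * u1 (x v)) * ∑ v, π v * gm (x v)) ≤ H := by
    refine two_mul_mul_indicator_le (A := fun a => i < a) (B := fun a => a < i) (g := g) hπ
      (fun b a hb ha => ?_) (fun a (ha : _ < _) (hb : _ < _) => by omega)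
    have ha' : (a : ℝ) + 1 ≤ i := by exact_mod_cast ha
    have hb' : (i : ℝ) + 1 ≤ b := by exact_mod_cast hb
    have := sq_sub_le_of_le_sub (a := a) (b := b) (t := i + 1 - a) (by linarith) (by linarith)
    rw [sq_sub_abs_comm]
    simp only [hg]
    linarith
  have q1 : ∑ v, π v * l0 (x v) + ∑ v, π v * u1 (x v) = 1 := by
    rw [← hsum, ← Finset.sum_add_distrib]
    refine Finset.sum_congr rfl fun v _ => ?_
    simp only [hl0, hu1]
    split_ifs <;> first | omega | ring
  have lin : ∀ (α β : ℤ → ℝ), (∀ a, α a ≤ β a) → ∑ v, π v * α (x v) ≤ ∑ v, π v * β (x v) :=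
    fun α β h => Finset.sum_le_sum fun v _ => mul_le_mul_of_nonneg_left (h _) (hπ v)
  have q2 : ∑ v, π v * F (x v) ≤ e + ∑ v, π v * l0 (x v) + (∑ v, π v * gm (x v)) / 2 := by
    have h1 := lin F (fun a => ((a : ℝ) - (i + 1)) + l0 a + gm a / 2) (by
      intro a
      simp only [hF, hl0, hgm, hg]
      rcases lt_trichotomy a i with h | h | h
      · have ha : (a : ℝ) + 1 ≤ i := by exact_mod_cast h
        rw [if_pos h.le, if_pos h, max_eq_right (by linarith)]
        nlinarith
      · subst h
        simp
      · have ha : (i : ℝ) + 1 ≤ a := by exact_mod_cast h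
        rw [if_neg (by omega), if_neg (by omega), max_eq_left (by linarith)]
        linarith)
    have h2 : ∑ v, π v * (((x v : ℝ) - (i + 1)) + l0 (x v) + gm (x v) / 2)
        = ∑ v, π v * (x v : ℝ) - (i + 1) + ∑ v, π v * l0 (x v) + (∑ v, π v * gm (x v)) / 2 := by
      simp only [mul_add, mul_sub, Finset.sum_add_distrib, Finset.sum_sub_distrib,
        ← Finset.sum_mul, hsum, ← mul_div_assoc, ← Finset.sum_div]
      ring
    linarith
  have q3 : ∑ v, π v * gp (x v) ≤ 2 * ∑ v, π v * F (x v) + 3 * ∑ v, π v * gpp (x v) := by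
    have h1 := lin gp (fun a => 2 * F a + 3 * gpp a) (by
      intro a
      simp only [hF, hgp, hgpp]
      have hm := le_max_right ((a : ℝ) - i - 1) 0
      have hm' := le_max_left ((a : ℝ) - i - 1) 0
      split_ifs with h1 h2
      · linarith
      · have : a = i + 2 := by omega
        subst this
        simp only [hg]
        push_cast at *
        nlinarith
      · omega
      · linarith)
    have h2 : ∑ v, π v * (2 * F (x v) + 3 * gpp (x v))
        = 2 * ∑ v, π v * F (x v) + 3 * ∑ v, π v * gpp (x v) := by
      rw [Finset.mul_sum, Finset.mul_sum, ← Finset.sum_add_distrib]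
      exact Finset.sum_congr rfl fun v _ => by ring
    linarith
  have q4 : 1 ≤ ∑ v, π v * l1 (x v) + ∑ v, π v * F (x v) := by
    have h1 := lin (fun _ => 1) (fun a => l1 a + F a) (by
      intro a
      simp only [hF, hl1]
      have hm := le_max_right ((a : ℝ) - i - 1) 0
      have hm' := le_max_left ((a : ℝ) - i - 1) 0
      split_ifs with h1
      · linarith
      · have : (i : ℝ) + 2 ≤ a := by exact_mod_cast (show i + 2 ≤ a by omega)
        linarith)
    simp only [mul_one, mul_add, Finset.sum_add_distrib, hsum] at h1
    exact h1
  have q5 : ∑ v, π v * gp (x v) ≤ spread π i x := lin gp g (by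
    intro a
    simp only [hgp]
    split_ifs
    · exact le_rfl
    · exact hg0 a)
  have nn : ∀ α : ℤ → ℝ, (∀ a, 0 ≤ α a) → 0 ≤ ∑ v, π v * α (x v) :=
    fun α h => Finset.sum_nonneg fun v _ => mul_nonneg (hπ v) (h _)
  have n1 := nn gp (fun a => by simp only [hgp]; split_ifs; exacts [hg0 a, le_rfl])
  have n2 := nn gm (fun a => by simp only [hgm]; split_ifs; exacts [hg0 a, le_rfl])
  have n3 := nn gpp (fun a => by
    simp only [hgpp]; split_ifs; exacts [div_nonneg (hg0 a) (by norm_num), le_rfl])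
  change ∑ v, π v * gp (x v) ≤ _
  set P0 := ∑ v, π v * l0 (x v)
  set Gp := ∑ v, π v * gp (x v)
  set Gpp := ∑ v, π v * gpp (x v)
  set Gm := ∑ v, π v * gm (x v)
  set P1 := ∑ v, π v * l1 (x v)
  set U1 := ∑ v, π v * u1 (x v)
  set Fp := ∑ v, π v * F (x v)
  have hεH : 4 * H ≤ 4 / ε * H := by
    apply mul_le_mul_of_nonneg_right _ hH0
    rw [le_div_iff₀ hε]
    linarith
  -- If opinions at most `i` have mass at least `ε/8`, pairing them with the high opinions bounds
  -- `Gp` directly. Otherwise almost all mass lies above `i`, and the bound on the mean makes the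
  -- excess `Fp` over `i + 1` small.
  by_cases hP0 : ε / 8 ≤ P0
  · have h1 : ε / 8 * Gp ≤ P0 * Gp := mul_le_mul_of_nonneg_right hP0 n1
    have h2 : Gp ≤ 4 / ε * H := by
      rw [div_mul_eq_mul_div, le_div_iff₀ hε]
      linarith
    nlinarith [sq_nonneg e]
  · push Not at hP0
    have hU : 7 / 8 ≤ U1 := by linarith
    have h1 : 7 / 8 * Gm ≤ U1 * Gm := mul_le_mul_of_nonneg_right hU n2
    have hFp : Fp ≤ ε / 8 + 2 / 7 * H + e := by linarith
    -- If half the mass is at most `i + 1`, it pairs with opinions from `i + 3` on. If not, `q4`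
    -- forces `Fp > 1/2`, so `H` or `e` is of order one and the a priori bound `hG` suffices.
    by_cases hP1 : 1 / 2 ≤ P1
    · have h2 : 1 / 2 * Gpp ≤ P1 * Gpp := mul_le_mul_of_nonneg_right hP1 n3
      nlinarith [sq_nonneg e]
    · push Not at hP1
      nlinarith [sq_nonneg e]

/-- Variance plus a function of the mean alone, which is nonpositive when the mean lies in `[i, i +
1]`. -/
theorem spread_eq (hsum : ∑ v, π v = 1) (i : ℤ) : spread π i x =
    (∑ v, π v * (x v : ℝ) ^ 2 - (∑ v, π v * (x v : ℝ)) ^ 2)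
      + ((∑ v, π v * (x v : ℝ)) - i) * ((∑ v, π v * (x v : ℝ)) - i - 1) := by
  have : ∀ v, π v * (((x v : ℝ) - i) * ((x v : ℝ) - i - 1))
      = π v * (x v : ℝ) ^ 2 - (2 * i + 1) * (π v * x v) + i * (i + 1) * π v := fun v => by ring
  simp only [spread, this, Finset.sum_add_distrib, Finset.sum_sub_distrib, ← Finset.mul_sum, hsum]
  ring

/-- Since `d² - |d| ≥ (d² - 1)/2` and the mean of `d²` is twice the variance, the pair spread is at
least the variance minus `1/2`; variance at least `1` absorbs the loss. -/
theorem variance_le_pairSpread (hπ : ∀ v, 0 ≤ π v) (hsum : ∑ v, π v = 1)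
    (hV : 1 ≤ ∑ v, π v * (x v : ℝ) ^ 2 - (∑ v, π v * (x v : ℝ)) ^ 2) :
    ∑ v, π v * (x v : ℝ) ^ 2 - (∑ v, π v * (x v : ℝ)) ^ 2 ≤ 2 * pairSpread π x := by
  have h1 : ∑ v, ∑ w, π v * π w * (((x v : ℝ) - x w) ^ 2 / 2 - 1 / 2) ≤ pairSpread π x := by
    refine Finset.sum_le_sum fun v _ => Finset.sum_le_sum fun w _ =>
      mul_le_mul_of_nonneg_left ?_ (mul_nonneg (hπ v) (hπ w))
    rw [← sq_abs]
    nlinarith [sq_nonneg (|(x v : ℝ) - x w| - 1)]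
  have h2 : ∑ v, ∑ w, π v * π w * (((x v : ℝ) - x w) ^ 2 / 2 - 1 / 2)
      = ∑ v, π v * (x v : ℝ) ^ 2 - (∑ v, π v * (x v : ℝ)) ^ 2 - 1 / 2 := by
    have e : ∀ v w, π v * π w * (((x v : ℝ) - x w) ^ 2 / 2 - 1 / 2)
        = (π v * (x v : ℝ) ^ 2) * π w / 2 + π v * (π w * (x w : ℝ) ^ 2) / 2
          - (π v * x v) * (π w * x w) - π v * π w / 2 := fun v w => by ring
    simp only [e, Finset.sum_sub_distrib, Finset.sum_add_distrib, ← Finset.sum_div,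
      ← Finset.mul_sum, ← Finset.sum_mul, hsum]
    ring
  linarith

theorem pairSpread_neg : pairSpread π (fun v => -x v) = pairSpread π x := by
  refine Finset.sum_congr rfl fun v _ => Finset.sum_congr rfl fun w _ => ?_
  push_cast
  rw [show -(x v : ℝ) - -(x w : ℝ) = -((x v : ℝ) - x w) by ring, abs_neg, neg_sq]

/-- Reflection exchanges the roles of `i` and `i + 1`, so the part of the spread below `i` is
handled by the bound for the upper part. -/
theorem spread_neg (i : ℤ) : spread π (-i - 1) (fun v => -x v) = spread π i x := by
  refine Finset.sum_congr rfl fun v _ => ?_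
  push_cast
  ring

/-- Opinions with little pair spread are concentrated on two adjacent values; `e` is the distance
of their mean from `[i, i + 1]`. -/
theorem spread_le (hπ : ∀ v, 0 ≤ π v) (hsum : ∑ v, π v = 1) {i : ℤ} {e ε : ℝ}
    (he : 0 ≤ e) (hc1 : i - e ≤ ∑ v, π v * (x v : ℝ)) (hc2 : ∑ v, π v * (x v : ℝ) ≤ i + 1 + e)
    (hε : 0 < ε) (hε1 : ε ≤ 1) :
    spread π i x ≤ ε + 8 / ε * pairSpread π x + 34 / ε * e ^ 2 := by
  have hH0 : 0 ≤ pairSpread π x := pairSpread_nonneg hπ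
  have hcc : ((∑ v, π v * (x v : ℝ)) - i) * ((∑ v, π v * (x v : ℝ)) - i - 1) ≤ e + e ^ 2 := by
    nlinarith
  have hHε : 8 * pairSpread π x ≤ 8 / ε * pairSpread π x := by
    apply mul_le_mul_of_nonneg_right _ hH0
    rw [le_div_iff₀ hε]
    linarith
  -- The linear term is traded for `e²`, since only the second moment of the displacement of the
  -- mean will be controlled.
  have heε : 8 * e ≤ ε / 2 + 32 / ε * e ^ 2 := by
    have : ε / 2 + 32 / ε * e ^ 2 - 8 * e = (ε - 8 * e) ^ 2 / (2 * ε) := by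
      field_simp
      ring
    have : 0 ≤ (ε - 8 * e) ^ 2 / (2 * ε) := by positivity
    linarith
  have heε2 : 2 * e ^ 2 ≤ 2 / ε * e ^ 2 := by
    apply mul_le_mul_of_nonneg_right _ (sq_nonneg _)
    rw [le_div_iff₀ hε]
    linarith
  have hsplit : 34 / ε * e ^ 2 = 32 / ε * e ^ 2 + 2 / ε * e ^ 2 := by ring
  rw [hsplit]
  -- Large variance is controlled by the pair spread alone. Small variance supplies the a priori
  -- bound that `upper_spread_le` requires.
  by_cases hV : 1 ≤ ∑ v, π v * (x v : ℝ) ^ 2 - (∑ v, π v * (x v : ℝ)) ^ 2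
  · have := variance_le_pairSpread hπ hsum hV
    rw [spread_eq hsum]
    have : 0 ≤ e ^ 2 := sq_nonneg e
    linarith
  · have hG : spread π i x ≤ 1 + e + e ^ 2 := by
      rw [spread_eq hsum]
      linarith
    have h1 := upper_spread_le hπ hsum he hc2 hε hε1 hG
    have h2 := upper_spread_le (x := fun v => -x v) (i := -i - 1) hπ hsum he (by
      push_cast
      simp only [mul_neg, Finset.sum_neg_distrib]
      linarith) hε hε1 (by rwa [spread_neg])
    rw [pairSpread_neg] at h2
    have h3 : spread π i x ≤
        ∑ v, π v * (if i + 1 < x v then ((x v : ℝ) - i) * ((x v : ℝ) - i - 1) else 0)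
        + ∑ v, π v * (if -i - 1 + 1 < -x v then (((-x v : ℤ) : ℝ) - ((-i - 1 : ℤ) : ℝ)) *
          (((-x v : ℤ) : ℝ) - ((-i - 1 : ℤ) : ℝ) - 1) else 0) := by
      rw [← Finset.sum_add_distrib]
      refine Finset.sum_le_sum fun v _ => ?_
      rw [← mul_add]
      refine mul_le_mul_of_nonneg_left ?_ (hπ v)
      push_cast
      split_ifs with ha hb hb
      · omega
      · linarith
      · nlinarith
      · have : x v = i ∨ x v = i + 1 := by omega
        rcases this with h | h <;> simp [h]
    have h4 : 8 / ε * pairSpread π x = 4 / ε * pairSpread π x + 4 / ε * pairSpread π x := by ring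
    linarith

/-- Here `d² - |d| = |d|(|d| - 1)` and `|d| ≤ k`. This is where the factor `k` in the relaxation
time comes from. -/
theorem pairSpread_le_mul (hπ : ∀ v, 0 ≤ π v) {k : ℕ} (hx : ∀ v, 1 ≤ x v ∧ x v ≤ k) :
    pairSpread π x ≤ k * ∑ v, ∑ w, π v * π w * max (|(x v : ℝ) - x w| - 1) 0 := by
  rw [Finset.mul_sum]
  refine Finset.sum_le_sum fun v _ => ?_
  rw [Finset.mul_sum]
  refine Finset.sum_le_sum fun w _ => ?_
  rw [mul_left_comm]
  refine mul_le_mul_of_nonneg_left ?_ (mul_nonneg (hπ v) (hπ w))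
  have hb : ∀ v, (1:ℝ) ≤ x v ∧ (x v : ℝ) ≤ k := fun v => ⟨by exact_mod_cast (hx v).1,
    by exact_mod_cast (hx v).2⟩
  have hd : |(x v : ℝ) - x w| ≤ k := by
    rw [abs_le]
    constructor <;> linarith [(hb v).1, (hb v).2, (hb w).1, (hb w).2]
  rw [← sq_abs]
  have h0 := abs_nonneg ((x v : ℝ) - x w)
  set d := |(x v : ℝ) - x w|
  have h1 := le_max_left (d - 1) 0
  have h2 := le_max_right (d - 1) 0
  nlinarith

end Integers

/-! ### Independent choices -/

section Sequences

variable {E : Type*} {t : ℕ}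

theorem exists_eq_comp_restrict {β : Type*} [Nonempty E] {f : (ℕ → E) → β}
    (hf : ∀ ω ω' : ℕ → E, (∀ s < t, ω s = ω' s) → f ω = f ω') :
    ∃ F : ((Finset.range t) → E) → β, f = F ∘ (Finset.range t).restrict := by
  refine ⟨fun h => f fun s => if hs : s ∈ Finset.range t then h ⟨s, hs⟩ else Classical.arbitrary E,
    funext fun ω => hf _ _ fun s hs => ?_⟩
  simp [hs]

variable [Fintype E] [MeasurableSpace E] [MeasurableSingletonClass E]

theorem integrable_of_finitely_many (p : PMF E) [Nonempty E] {f : (ℕ → E) → ℝ}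
    (hf : ∀ ω ω' : ℕ → E, (∀ s < t, ω s = ω' s) → f ω = f ω') :
    Integrable f (Measure.infinitePi fun _ : ℕ => p.toMeasure) := by
  obtain ⟨F, rfl⟩ := exists_eq_comp_restrict hf
  exact (Integrable.of_finite (μ := Measure.map (Finset.range t).restrict
    (Measure.infinitePi fun _ : ℕ => p.toMeasure))).comp_measurable
      (Finset.measurable_restrict _)

/-- Averaging over the next independent choice. -/
theorem integral_next_choice (p : PMF E) [Nonempty E] {f : (ℕ → E) → E → ℝ}
    (hf : ∀ ω ω' : ℕ → E, (∀ s < t, ω s = ω' s) → f ω = f ω') :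
    ∫ ω, f ω (ω t) ∂(Measure.infinitePi fun _ : ℕ => p.toMeasure)
      = ∫ ω, ∑ e, (p e).toReal * f ω e ∂(Measure.infinitePi fun _ : ℕ => p.toMeasure) := by
  set μ := Measure.infinitePi fun _ : ℕ => p.toMeasure with hμ
  have hint : ∀ e, Integrable (fun ω => f ω e) μ := fun e =>
    integrable_of_finitely_many p fun ω ω' h => by rw [hf ω ω' h]
  -- Splitting by the value of the new choice leaves products of a function of coordinate `t` and a
  -- function of earlier ones, which are independent.
  have h1 : ∀ ω, f ω (ω t) = ∑ e, (if ω t = e then 1 else 0) * f ω e := by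
    intro ω
    simp
  have hprod : ∀ e, Integrable (fun ω : ℕ → E => (if ω t = e then 1 else 0) * f ω e) μ :=
    fun e => integrable_of_finitely_many (t := t + 1) p fun ω ω' h => by
      rw [hf ω ω' fun s hs => h s (by omega), h t (by omega)]
  simp_rw [h1]
  rw [integral_finsetSum _ fun e _ => hprod e,
    integral_finsetSum _ fun e _ => (hint e).const_mul _]
  refine Finset.sum_congr rfl fun e _ => ?_
  rw [integral_const_mul]
  have hindep : ProbabilityTheory.iIndepFun (fun (i : ℕ) (ω : ℕ → E) => ω i) μ :=
    ProbabilityTheory.iIndepFun_infinitePi (X := fun _ e => e) fun _ => measurable_id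
  have hind := hindep.indepFun_finset (Finset.range t) {t} (by simp)
    (fun i => measurable_pi_apply i)
  obtain ⟨F, hF⟩ := exists_eq_comp_restrict (f := fun ω => f ω e)
    (fun ω ω' h => by rw [hf ω ω' h])
  have hind2 := (hind.comp (φ := F)
    (ψ := fun g : ({t} : Finset ℕ) → E => if g ⟨t, by simp⟩ = e then (1:ℝ) else 0)
    (measurable_of_countable _) (measurable_of_countable _)).symm
  have hmul := hind2.integral_mul_eq_mul_integral
    (AEMeasurable.aestronglyMeasurable (Measurable.aemeasurable (by
      refine (measurable_of_countable _).comp ?_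
      exact measurable_pi_lambda _ fun i => measurable_pi_apply _)))
    (AEMeasurable.aestronglyMeasurable (Measurable.aemeasurable (by
      refine (measurable_of_countable _).comp ?_
      exact measurable_pi_lambda _ fun i => measurable_pi_apply _)))
  have e1 : ∫ ω : ℕ → E, (if ω t = e then (1:ℝ) else 0) ∂μ = (p e).toReal := by
    have hmeas : MeasurableSet {ω : ℕ → E | ω t = e} :=
      measurableSet_eq_fun (measurable_pi_apply t) measurable_const
    have : (fun ω : ℕ → E => if ω t = e then (1:ℝ) else 0)
        = Set.indicator {ω : ℕ → E | ω t = e} 1 := by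
      funext ω
      simp [Set.indicator]
    rw [this, integral_indicator_one hmeas, Measure.real]
    have h2 : μ {ω : ℕ → E | ω t = e} = (Measure.map (fun ω : ℕ → E => ω t) μ) {e} := by
      rw [Measure.map_apply (measurable_pi_apply t) (measurableSet_singleton e)]
      rfl
    rw [h2, hμ, Measure.infinitePi_map_eval, PMF.toMeasure_apply_singleton _ _
      (measurableSet_singleton e)]
  rw [← e1]
  have hF' : ∀ ω, f ω e = F ((Finset.range t).restrict ω) := fun ω => congrFun hF ω
  simp_rw [hF']
  exact hmul

end Sequences

/-! ### Invariance of the opinion range, and consensus as an absorbing state -/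

section Dynamics

variable {V : Type*}

theorem opinions_congr {x : V → ℤ} {t : ℕ} {ω ω' : ℕ → V × V} (h : ∀ s < t, ω s = ω' s) :
    opinions x ω t = opinions x ω' t := by
  induction t with
  | zero => rfl
  | succ t ih => rw [opinions, opinions, ih fun s hs => h s (by omega), h t (by omega)]

theorem update_mem_box {k : ℕ} {x : V → ℤ} (hx : ∀ v, 1 ≤ x v ∧ x v ≤ k) (v w : V) :
    ∀ u, 1 ≤ update x v w u ∧ update x v w u ≤ k := by
  intro u
  have h1 := hx v
  have h2 := hx w
  have h3 := hx u
  unfold update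
  by_cases h : u = v
  · subst h
    rw [Function.update_self]
    split_ifs <;> omega
  · rwa [Function.update_of_ne h]

theorem opinions_mem_box {k : ℕ} {x : V → ℤ} (hx : ∀ v, 1 ≤ x v ∧ x v ≤ k) (ω : ℕ → V × V)
    (t : ℕ) : ∀ v, 1 ≤ opinions x ω t v ∧ opinions x ω t v ≤ k := by
  induction t with
  | zero => exact hx
  | succ t ih => exact update_mem_box ih _ _

theorem opinions_const_of_le {x : V → ℤ} {a : ℤ} {ω : ℕ → V × V} {s t : ℕ} (hst : s ≤ t)
    (h : ∀ v, opinions x ω s v = a) : ∀ v, opinions x ω t v = a := by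
  induction t, hst using Nat.le_induction with
  | base => exact h
  | succ t _ ih =>
    intro v
    rw [opinions, update]
    by_cases hv : v = (ω t).1
    · rw [hv, Function.update_self]
      simp [ih]
    · rw [Function.update_of_ne hv, ih]

end Dynamics

/-! ### The opinions as a Markov chain -/

section Chain

variable {V : Type*} [Fintype V] [Nonempty V] {G : SimpleGraph V}

/-- The mean of `φ` after one step from `x`. -/
noncomputable def stepMean (G : SimpleGraph V) (φ : (V → ℤ) → ℝ) (x : V → ℤ) : ℝ :=
  ∑ e : V × V, (choice G e).toReal * φ (update x e.1 e.2)

/-- The mean of `φ` after `t` steps from `x`. -/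
noncomputable def stateMean (G : SimpleGraph V) (x : V → ℤ) (t : ℕ) (φ : (V → ℤ) → ℝ) : ℝ :=
  letI : MeasurableSpace (V × V) := ⊤
  ∫ ω, φ (opinions x ω t) ∂(Measure.infinitePi fun _ : ℕ => (choice G).toMeasure)

theorem stateMean_zero (x : V → ℤ) (φ : (V → ℤ) → ℝ) : stateMean G x 0 φ = φ x := by
  let _ : MeasurableSpace (V × V) := ⊤
  simp [stateMean, opinions]

theorem stateMean_succ (x : V → ℤ) (t : ℕ) (φ : (V → ℤ) → ℝ) :
    stateMean G x (t + 1) φ = stateMean G x t (stepMean G φ) := by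
  let _ : MeasurableSpace (V × V) := ⊤
  exact integral_next_choice (t := t) (choice G)
    (f := fun ω e => φ (update (opinions x ω t) e.1 e.2))
    fun ω ω' h => by rw [opinions_congr h]

theorem stateMean_add (x : V → ℤ) (t : ℕ) (φ ψ : (V → ℤ) → ℝ) :
    stateMean G x t (fun y => φ y + ψ y) = stateMean G x t φ + stateMean G x t ψ := by
  let _ : MeasurableSpace (V × V) := ⊤
  exact integral_add (integrable_of_finitely_many (t := t) _ fun ω ω' h => by rw [opinions_congr h])
    (integrable_of_finitely_many (t := t) _ fun ω ω' h => by rw [opinions_congr h])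

theorem stateMean_const_mul (x : V → ℤ) (t : ℕ) (r : ℝ) (φ : (V → ℤ) → ℝ) :
    stateMean G x t (fun y => r * φ y) = r * stateMean G x t φ := by
  let _ : MeasurableSpace (V × V) := ⊤
  exact integral_const_mul _ _

theorem stateMean_const (x : V → ℤ) (t : ℕ) (r : ℝ) : stateMean G x t (fun _ => r) = r := by
  let _ : MeasurableSpace (V × V) := ⊤
  simp [stateMean]

theorem stateMean_mono {k : ℕ} {x : V → ℤ} (hx : ∀ v, 1 ≤ x v ∧ x v ≤ k) (t : ℕ)
    {φ ψ : (V → ℤ) → ℝ} (h : ∀ y : V → ℤ, (∀ v, 1 ≤ y v ∧ y v ≤ k) → φ y ≤ ψ y) :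
    stateMean G x t φ ≤ stateMean G x t ψ := by
  let _ : MeasurableSpace (V × V) := ⊤
  exact integral_mono
    (integrable_of_finitely_many (t := t) _ fun ω ω' h => by rw [opinions_congr h])
    (integrable_of_finitely_many (t := t) _ fun ω ω' h => by rw [opinions_congr h])
    fun ω => h _ (opinions_mem_box hx ω t)

theorem prob_state (x : V → ℤ) (t : ℕ) (p : (V → ℤ) → Prop)
    [DecidablePred p] :
    prob G {ω | p (opinions x ω t)} = stateMean G x t fun y => if p y then 1 else 0 := by
  let _ : MeasurableSpace (V × V) := ⊤
  have hm : MeasurableSet {ω : ℕ → V × V | p (opinions x ω t)} := by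
    obtain ⟨F, hF⟩ := exists_eq_comp_restrict (t := t) (f := fun ω => p (opinions x ω t))
      fun ω ω' h => by rw [opinions_congr h]
    have : {ω : ℕ → V × V | p (opinions x ω t)}
        = (Finset.range t).restrict ⁻¹' {g : (Finset.range t) → V × V | F g} := by
      ext ω
      exact (congrFun hF ω).to_iff
    rw [this]
    exact Finset.measurable_restrict _ (Set.toFinite _).measurableSet
  have : (fun ω : ℕ → V × V => if p (opinions x ω t) then (1:ℝ) else 0)
      = Set.indicator {ω : ℕ → V × V | p (opinions x ω t)} 1 := by
    funext ω
    simp [Set.indicator]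
  simp only [stateMean, prob]
  rw [this, integral_indicator_one hm]

theorem prob_mono {A B : Set (ℕ → V × V)} (h : A ⊆ B) : prob G A ≤ prob G B := by
  let _ : MeasurableSpace (V × V) := ⊤
  exact measureReal_mono h

theorem prob_le_one (A : Set (ℕ → V × V)) : prob G A ≤ 1 := by
  let _ : MeasurableSpace (V × V) := ⊤
  exact measureReal_le_one

/-- Consensus is absorbing, so the events of consensus on `a` at time `t` increase to `Wins x a`,
and continuity from below applies. -/
theorem tendsto_prob_wins (x : V → ℤ) (a : ℤ) :
    Tendsto (fun t => stateMean G x t fun y => if ∀ v, y v = a then 1 else 0) atTop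
      (𝓝 (prob G (Wins x a))) := by
  let _ : MeasurableSpace (V × V) := ⊤
  have h1 : Monotone fun t => {ω : ℕ → V × V | ∀ v, opinions x ω t v = a} :=
    fun s t hst ω h => opinions_const_of_le hst h
  have h2 : Wins x a = ⋃ t, {ω : ℕ → V × V | ∀ v, opinions x ω t v = a} := by
    ext ω
    simp [Wins]
  have h3 := tendsto_measure_iUnion_atTop
    (μ := Measure.infinitePi fun _ : ℕ => (choice G).toMeasure) h1
  rw [← h2] at h3
  have h4 := (ENNReal.tendsto_toReal (measure_ne_top _ _)).comp h3
  refine h4.congr fun t => ?_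
  exact prob_state (G := G) x t fun y => ∀ v, y v = a

theorem choice_apply (hG : G.Connected) (hV : 2 ≤ Fintype.card V) (v w : V) :
    (choice G (v, w)).toReal = 1 / (Fintype.card V : ℝ) * walkMatrix G v w := by
  have hne : ∀ u, (G.neighborFinset u).Nonempty := fun u => by
    rw [← Finset.card_pos, SimpleGraph.card_neighborFinset_eq_degree]
    exact degree_pos_of_connected hG hV u
  rw [choice, PMF.bind_apply, tsum_fintype, Finset.sum_eq_single v]
  · rw [dif_pos (hne v), PMF.map_apply, tsum_fintype, Finset.sum_eq_single w]
    · simp only [if_true, PMF.uniformOfFintype_apply, PMF.uniformOfFinset_apply, walkMatrix,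
        Matrix.of_apply, SimpleGraph.mem_neighborFinset, SimpleGraph.card_neighborFinset_eq_degree]
      split_ifs <;> simp
    · intro u _ hu
      rw [if_neg]
      simp [hu.symm]
    · simp
  · intro u _ hu
    rw [dif_pos (hne u), PMF.map_apply, ENNReal.tsum_eq_zero.2, mul_zero]
    intro z
    rw [if_neg]
    simp [hu.symm]
  · simp

theorem stepMean_eq (hG : G.Connected) (hV : 2 ≤ Fintype.card V) (φ : (V → ℤ) → ℝ) (x : V → ℤ) :
    stepMean G φ x = 1 / (Fintype.card V : ℝ) *
      ∑ v, ∑ w, walkMatrix G v w * φ (update x v w) := by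
  rw [stepMean, Fintype.sum_prod_type, Finset.mul_sum]
  refine Finset.sum_congr rfl fun v _ => ?_
  rw [Finset.mul_sum]
  exact Finset.sum_congr rfl fun w _ => by rw [choice_apply hG hV]; ring

/-- One step in terms of the increments. -/
theorem stepMean_eq_add (hG : G.Connected) (hV : 2 ≤ Fintype.card V) (φ : (V → ℤ) → ℝ)
    (x : V → ℤ) (D : V → V → ℝ) (h : ∀ v w, φ (update x v w) = φ x + stationary G v * D v w) :
    stepMean G φ x = φ x + 1 / (Fintype.card V : ℝ) * ∑ v, ∑ w, edgeMeasure G v w * D v w := by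
  have hn : (0:ℝ) < Fintype.card V := by exact_mod_cast (by omega : 0 < Fintype.card V)
  rw [stepMean_eq hG hV]
  simp_rw [h, mul_add, Finset.sum_add_distrib, ← Finset.sum_mul, sum_walkMatrix hG hV]
  rw [Finset.sum_const, Finset.card_univ, nsmul_eq_mul, mul_one, mul_add]
  congr 1
  · field_simp
  · congr 1
    -- The weight `π_v` of the updated vertex turns the walk probabilities into the symmetric `Q`,
    -- which makes the later cancellations possible.
    refine Finset.sum_congr rfl fun v _ => Finset.sum_congr rfl fun w _ => ?_
    rw [← stationary_mul_walkMatrix hG hV]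
    ring

end Chain

/-! ### One-step drifts -/

section Drift

/-- The move of an opinion `a` that observes the opinion `b`. -/
noncomputable def move (a b : ℤ) : ℝ := if a < b then 1 else if b < a then -1 else 0

theorem move_comm (a b : ℤ) : move b a = -move a b := by
  unfold move
  split_ifs <;> first | omega | simp

theorem move_sq (a b : ℤ) : move a b ^ 2 = if a = b then 0 else 1 := by
  unfold move
  split_ifs <;> first | omega | simp

theorem update_apply_self {V : Type*} (x : V → ℤ) (v w : V) :
    (update x v w v : ℝ) = x v + move (x v) (x w) := by
  rw [update, Function.update_self, move]
  split_ifs <;> push_cast <;> ring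

variable {V : Type*} {G : SimpleGraph V}

theorem exists_adj_ne (hG : G.Connected) {x : V → ℤ} (hx : ¬ ∃ a, ∀ v, x v = a) : ∃ v w, G.Adj v w ∧ x v ≠ x w := by
  by_contra! h
  apply hx
  obtain ⟨u⟩ := hG.nonempty
  refine ⟨x u, fun v => ?_⟩
  obtain ⟨p⟩ := hG.preconnected v u
  induction p with
  | nil => rfl
  | cons hadj _ ih => rw [h _ _ hadj, ih]

variable [Fintype V]

theorem sum_mul_update (π : V → ℝ) (f : ℝ → ℝ) (x : V → ℤ) (v w : V) :
    ∑ u, π u * f (update x v w u) = ∑ u, π u * f (x u)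
      + π v * (f (x v + move (x v) (x w)) - f (x v)) := by
  have h : ∀ u, π u * f (update x v w u) = π u * f (x u)
      + if u = v then π v * (f (x v + move (x v) (x w)) - f (x v)) else 0 := by
    intro u
    by_cases hu : u = v
    · subst hu
      rw [update_apply_self, if_pos rfl]
      ring
    · rw [update, Function.update_of_ne hu, if_neg hu, add_zero]
  simp_rw [h, Finset.sum_add_distrib, Finset.sum_ite_eq', Finset.mem_univ, if_true]

theorem weightedAverage_update (x : V → ℤ) (v w : V) : weightedAverage G (update x v w)
    = weightedAverage G x + stationary G v * move (x v) (x w) := by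
  have := sum_mul_update (stationary G) id x v w
  simpa [weightedAverage] using this

/-- A symmetric weight against an antisymmetric move; this is the martingale property of the
weighted average. -/
theorem sum_edgeMeasure_mul_move (x : V → ℤ) :
    ∑ v, ∑ w, edgeMeasure G v w * move (x v) (x w) = 0 := by
  have h : ∑ v, ∑ w, edgeMeasure G v w * move (x v) (x w)
      = -∑ v, ∑ w, edgeMeasure G v w * move (x v) (x w) := by
    conv_lhs => rw [Finset.sum_comm]
    rw [← Finset.sum_neg_distrib]
    refine Finset.sum_congr rfl fun v _ => ?_
    rw [← Finset.sum_neg_distrib]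
    refine Finset.sum_congr rfl fun w _ => ?_
    rw [edgeMeasure_comm, move_comm (x v)]
    ring
  linarith

theorem move_mul_sub (a b : ℤ) :
    move a b * ((a : ℝ) - b) + move a b ^ 2 = -max (|(a : ℝ) - b| - 1) 0 := by
  unfold move
  rcases lt_trichotomy a b with h | h | h
  · have hab : (a : ℝ) + 1 ≤ b := by exact_mod_cast h
    rw [if_pos h, abs_of_nonpos (by linarith), max_eq_left (by linarith)]
    ring
  · subst h
    simp
  · have hab : (b : ℝ) + 1 ≤ a := by exact_mod_cast h
    rw [if_neg (by omega), if_pos h, abs_of_nonneg (by linarith), max_eq_left (by linarith)]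
    ring

theorem stepMean_weightedAverage [Nonempty V] (hG : G.Connected) (hV : 2 ≤ Fintype.card V)
    (x : V → ℤ) :
    stepMean G (weightedAverage G) x = weightedAverage G x := by
  rw [stepMean_eq_add hG hV _ x (fun v w => move (x v) (x w)) (weightedAverage_update x),
    sum_edgeMeasure_mul_move, mul_zero, add_zero]

theorem stepMean_sq [Nonempty V] (hG : G.Connected) (hV : 2 ≤ Fintype.card V)
    (r : ℝ) (x : V → ℤ) :
    stepMean G (fun y => (weightedAverage G y - r) ^ 2) x = (weightedAverage G x - r) ^ 2
      + 1 / (Fintype.card V : ℝ) * ∑ v, ∑ w, edgeMeasure G v w *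
        (stationary G v * if x v = x w then 0 else 1) := by
  rw [stepMean_eq_add hG hV _ x (fun v w => 2 * (weightedAverage G x - r) * move (x v) (x w)
    + stationary G v * if x v = x w then 0 else 1)]
  · congr 2
    simp_rw [mul_add, Finset.sum_add_distrib]
    have : ∑ v, ∑ w, edgeMeasure G v w * (2 * (weightedAverage G x - r) * move (x v) (x w))
        = 2 * (weightedAverage G x - r) * ∑ v, ∑ w, edgeMeasure G v w * move (x v) (x w) := by
      simp_rw [Finset.mul_sum]
      exact Finset.sum_congr rfl fun v _ => Finset.sum_congr rfl fun w _ => by ring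
    rw [this, sum_edgeMeasure_mul_move]
    ring
  · intro v w
    rw [weightedAverage_update, ← move_sq]
    ring

theorem stepMean_sq_le [Nonempty V] (hG : G.Connected) (hV : 2 ≤ Fintype.card V)
    (r : ℝ) (x : V → ℤ) :
    stepMean G (fun y => (weightedAverage G y - r) ^ 2) x ≤ (weightedAverage G x - r) ^ 2
      + (∑ v, stationary G v ^ 2) / Fintype.card V := by
  rw [stepMean_sq hG hV, show (∑ v, stationary G v ^ 2) / (Fintype.card V : ℝ)
    = 1 / (Fintype.card V : ℝ) * ∑ v, stationary G v ^ 2 by ring]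
  have hn : 0 ≤ 1 / (Fintype.card V : ℝ) := by positivity
  refine add_le_add le_rfl (mul_le_mul_of_nonneg_left (Finset.sum_le_sum fun v _ => ?_) hn)
  calc ∑ w, edgeMeasure G v w * (stationary G v * if x v = x w then (0 : ℝ) else 1)
      ≤ ∑ w, edgeMeasure G v w * stationary G v := by
        refine Finset.sum_le_sum fun w _ =>
          mul_le_mul_of_nonneg_left ?_ (edgeMeasure_nonneg v w)
        have := (stationary_pos hG hV v).le
        split_ifs <;> simp [this]
    _ = stationary G v ^ 2 := by rw [← Finset.sum_mul, sum_edgeMeasure, sq]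

/-- Without consensus, connectivity gives an edge with differing opinions; that edge alone
contributes `Q π_v / n ≥ Q² / n` to the variance. -/
theorem le_stepMean_sq [Nonempty V] (hG : G.Connected) (hV : 2 ≤ Fintype.card V)
    (r : ℝ) (x : V → ℤ) :
    (weightedAverage G x - r) ^ 2 + (1 / (2 * (G.edgeFinset.card : ℝ))) ^ 2 / Fintype.card V *
      (if ∃ a, ∀ v, x v = a then 0 else 1)
      ≤ stepMean G (fun y => (weightedAverage G y - r) ^ 2) x := by
  rw [stepMean_sq hG hV]
  have hterm : ∀ v w, 0 ≤ edgeMeasure G v w * (stationary G v * if x v = x w then 0 else 1) := by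
    intro v w
    have := (stationary_pos hG hV v).le
    have := edgeMeasure_nonneg (G := G) v w
    split_ifs
    · simp
    · positivity
  refine add_le_add le_rfl ?_
  split_ifs with hx
  · rw [mul_zero]
    exact mul_nonneg (by positivity)
      (Finset.sum_nonneg fun v _ => Finset.sum_nonneg fun w _ => hterm v w)
  · obtain ⟨v, w, hadj, hne⟩ := exists_adj_ne hG hx
    have h1 : edgeMeasure G v w = 1 / (2 * (G.edgeFinset.card : ℝ)) := if_pos hadj
    have h2 : edgeMeasure G v w ≤ stationary G v := by
      rw [← sum_edgeMeasure]
      exact Finset.single_le_sum (fun u _ => edgeMeasure_nonneg v u) (Finset.mem_univ w)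
    rw [mul_one, ← h1, div_eq_inv_mul, ← one_div]
    gcongr
    have h3 := Finset.single_le_sum (fun u _ => hterm v u) (Finset.mem_univ w)
    have h4 := Finset.single_le_sum (f := fun v => ∑ w, edgeMeasure G v w *
      (stationary G v * if x v = x w then 0 else 1))
      (fun u _ => Finset.sum_nonneg fun w _ => hterm u w) (Finset.mem_univ v)
    refine le_trans ?_ (h3.trans h4)
    rw [if_neg hne, mul_one, sq]
    exact mul_le_mul_of_nonneg_left h2 (edgeMeasure_nonneg v w)

/-- Adding the increments for `(v, w)` and `(w, v)` cancels `i`: what remains is `2(m d + m²)`, with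
`m` the move and `d` the difference, and this is `-2 max(|d| - 1, 0)`. -/
theorem stepMean_spread [Nonempty V] (hG : G.Connected) (hV : 2 ≤ Fintype.card V)
    (i : ℤ) (x : V → ℤ) :
    stepMean G (spread (stationary G) i) x = spread (stationary G) i x
      - 1 / (Fintype.card V : ℝ) * ∑ v, ∑ w, edgeMeasure G v w *
        max (|(x v : ℝ) - x w| - 1) 0 := by
  rw [stepMean_eq_add hG hV _ x (fun v w => move (x v) (x w) * (2 * ((x v : ℝ) - i) - 1)
    + move (x v) (x w) ^ 2), sub_eq_add_neg, ← mul_neg]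
  · congr 2
    set D : V → V → ℝ := fun v w => edgeMeasure G v w *
      (move (x v) (x w) * (2 * ((x v : ℝ) - i) - 1) + move (x v) (x w) ^ 2) with hD
    have h1 : ∑ v, ∑ w, D v w = ∑ v, ∑ w, D w v := Finset.sum_comm
    have h2 : ∑ v, ∑ w, D v w + ∑ v, ∑ w, D w v
        = 2 * -∑ v, ∑ w, edgeMeasure G v w * max (|(x v : ℝ) - x w| - 1) 0 := by
      rw [← Finset.sum_add_distrib, ← Finset.sum_neg_distrib, Finset.mul_sum]
      refine Finset.sum_congr rfl fun v _ => ?_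
      rw [← Finset.sum_add_distrib, ← Finset.sum_neg_distrib, Finset.mul_sum]
      refine Finset.sum_congr rfl fun w _ => ?_
      have := move_mul_sub (x v) (x w)
      simp only [hD]
      rw [edgeMeasure_comm w v, move_comm (x v) (x w), ← mul_neg, ← this]
      ring
    linarith
  · intro v w
    have := sum_mul_update (stationary G) (fun z => (z - i) * (z - i - 1)) x v w
    simp only [spread]
    rw [this]
    ring

theorem stepMean_spread_le_self [Nonempty V] (hG : G.Connected) (hV : 2 ≤ Fintype.card V)
    (i : ℤ) (x : V → ℤ) :
    stepMean G (spread (stationary G) i) x ≤ spread (stationary G) i x := by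
  rw [stepMean_spread hG hV]
  have : 0 ≤ ∑ v, ∑ w, edgeMeasure G v w * max (|(x v : ℝ) - x w| - 1) 0 :=
    Finset.sum_nonneg fun v _ => Finset.sum_nonneg fun w _ =>
      mul_nonneg (edgeMeasure_nonneg v w) (le_max_right _ _)
  have : 0 ≤ 1 / (Fintype.card V : ℝ) *
    ∑ v, ∑ w, edgeMeasure G v w * max (|(x v : ℝ) - x w| - 1) 0 := by positivity
  linarith

/-- Chains `spread_le`, `pairSpread_le_mul` and `dissipation_lower_bound` into `ε Γ ≤ ε² + 16k(B +
lam² k) + 34 d`, with `B` the dissipation and `d` the squared displacement of the mean; dividing by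
`16kn` gives the constants. -/
theorem stepMean_spread_le [Nonempty V] (hG : G.Connected) (hV : 2 ≤ Fintype.card V)
    {k : ℕ} (hk : 1 ≤ k) {x : V → ℤ} (hx : ∀ v, 1 ≤ x v ∧ x v ≤ k) {i : ℤ}
    {c ε : ℝ} (hc1 : i ≤ c) (hc2 : c ≤ i + 1) (hε : 0 < ε) (hε1 : ε ≤ 1) :
    stepMean G (spread (stationary G) i) x ≤
      (1 - ε / (16 * k * Fintype.card V)) * spread (stationary G) i x
      + 17 / (8 * k * Fintype.card V) * (weightedAverage G x - c) ^ 2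
      + (ε ^ 2 / (16 * k) + secondEigenvalue G ^ 2 * k) / Fintype.card V := by
  have hm := isMixing_edgeMeasure hG hV
  have hπ := fun v => (stationary_pos hG hV v).le
  have hk0 : (0:ℝ) < k := by exact_mod_cast hk
  have hn : (0:ℝ) < Fintype.card V := by exact_mod_cast (by omega : 0 < Fintype.card V)
  have h1 := spread_le (x := x) (i := i) (e := |weightedAverage G x - c|) hπ hm.sum_one
    (abs_nonneg _) (by
      have := neg_abs_le (weightedAverage G x - c)
      simp only [weightedAverage] at this ⊢
      linarith) (by
      have := le_abs_self (weightedAverage G x - c)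
      simp only [weightedAverage] at this ⊢
      linarith) hε hε1
  have h2 := pairSpread_le_mul hπ hx
  have h3 := hm.dissipation_lower_bound hx
  rw [sq_abs] at h1
  rw [stepMean_spread hG hV]
  set Γ := spread (stationary G) i x
  set H := pairSpread (stationary G) x
  set B := ∑ v, ∑ w, edgeMeasure G v w * max (|(x v : ℝ) - x w| - 1) 0
  set M := ∑ v, ∑ w, stationary G v * stationary G w * max (|(x v : ℝ) - x w| - 1) 0
  set d := (weightedAverage G x - c) ^ 2
  set lam := secondEigenvalue G
  set n : ℝ := (Fintype.card V : ℝ)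
  have h4 : ε * Γ ≤ ε ^ 2 + 8 * (k * M) + 34 * d := by
    have : ε * Γ ≤ ε * (ε + 8 / ε * H + 34 / ε * d) := mul_le_mul_of_nonneg_left h1 hε.le
    have e : ε * (ε + 8 / ε * H + 34 / ε * d) = ε ^ 2 + 8 * H + 34 * d := by field_simp
    linarith
  have h5 : ε * Γ ≤ ε ^ 2 + 16 * k * (B + lam ^ 2 * k) + 34 * d := by
    have : k * M ≤ k * (2 * (B + lam ^ 2 * k)) := mul_le_mul_of_nonneg_left (by linarith) hk0.le
    linarith
  have h6 : (1 - ε / (16 * k * n)) * Γ + 17 / (8 * k * n) * d + (ε ^ 2 / (16 * k) + lam ^ 2 * k) / n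
      - (Γ - 1 / n * B) = (ε ^ 2 + 16 * k * (B + lam ^ 2 * k) + 34 * d - ε * Γ) / (16 * k * n) := by
    field_simp
    ring
  have h7 : 0 ≤ (ε ^ 2 + 16 * k * (B + lam ^ 2 * k) + 34 * d - ε * Γ) / (16 * k * n) :=
    div_nonneg (by linarith) (by positivity)
  linarith

end Drift

theorem le_pow_mul_add_of_le {a : ℕ → ℝ} {ρ η : ℝ} {T : ℕ} (hρ : ρ ≤ 1)
    (hη : 0 ≤ η) (h : ∀ t < T, a (t + 1) ≤ (1 - ρ) * a t + ρ * η) :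
    a T ≤ (1 - ρ) ^ T * a 0 + η := by
  induction T with
  | zero => simpa using hη
  | succ T ih =>
    have h1 := ih fun t ht => h t (by omega)
    have h2 := h T (by omega)
    have h3 := mul_le_mul_of_nonneg_left h1 (sub_nonneg.2 hρ)
    rw [pow_succ]
    linarith

/-! ### Long-time behaviour and the law of the winner -/

section Limit

variable {V : Type*} [Fintype V] {G : SimpleGraph V}

theorem weightedAverage_mem_box (hG : G.Connected) (hV : 2 ≤ Fintype.card V) {k : ℕ} {x : V → ℤ}
    (hx : ∀ v, 1 ≤ x v ∧ x v ≤ k) : 1 ≤ weightedAverage G x ∧ weightedAverage G x ≤ k := by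
  have hπ := fun v => (stationary_pos hG hV v).le
  have h1 := sum_stationary hG hV
  constructor
  · rw [← h1]
    refine Finset.sum_le_sum fun v _ => le_mul_of_one_le_right (hπ v) ?_
    exact_mod_cast (hx v).1
  · calc weightedAverage G x ≤ ∑ v, stationary G v * (k : ℝ) :=
          Finset.sum_le_sum fun v _ => mul_le_mul_of_nonneg_left (by exact_mod_cast (hx v).2) (hπ v)
      _ = k := by rw [← Finset.sum_mul, h1, one_mul]

theorem weightedAverage_of_consensus (hG : G.Connected) (hV : 2 ≤ Fintype.card V) {y : V → ℤ}
    {a : ℤ} (h : ∀ v, y v = a) : weightedAverage G y = a := by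
  simp only [weightedAverage, h]
  rw [← Finset.sum_mul, sum_stationary hG hV, one_mul]

theorem spread_of_consensus (hG : G.Connected) (hV : 2 ≤ Fintype.card V) {y : V → ℤ}
    {a : ℤ} (i : ℤ) (h : ∀ v, y v = a) :
    spread (stationary G) i y = ((a : ℝ) - i) * ((a : ℝ) - i - 1) := by
  simp only [spread, h]
  rw [← Finset.sum_mul, sum_stationary hG hV, one_mul]

theorem spread_le_sq (hG : G.Connected) (hV : 2 ≤ Fintype.card V) {k : ℕ} {x : V → ℤ}
    (hx : ∀ v, 1 ≤ x v ∧ x v ≤ k) {i : ℤ} (hi1 : i ≤ weightedAverage G x)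
    (hi2 : weightedAverage G x < i + 1) : spread (stationary G) i x ≤ (k : ℝ) ^ 2 := by
  have hπ := fun v => (stationary_pos hG hV v).le
  obtain ⟨h1, h2⟩ := weightedAverage_mem_box hG hV hx
  have hi0 : 1 ≤ i := by
    have : (0 : ℝ) < i := by linarith
    exact_mod_cast this
  have hik : i ≤ k := by
    have : (i : ℝ) ≤ k := by linarith
    exact_mod_cast this
  have hi0' : (1 : ℝ) ≤ i := by exact_mod_cast hi0
  have hik' : (i : ℝ) ≤ k := by exact_mod_cast hik
  calc spread (stationary G) i x ≤ ∑ v, stationary G v * (k : ℝ) ^ 2 := by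
        refine Finset.sum_le_sum fun v _ => mul_le_mul_of_nonneg_left ?_ (hπ v)
        have a1 : (1 : ℝ) ≤ x v := by exact_mod_cast (hx v).1
        have a2 : (x v : ℝ) ≤ k := by exact_mod_cast (hx v).2
        nlinarith
    _ = (k : ℝ) ^ 2 := by rw [← Finset.sum_mul, sum_stationary hG hV, one_mul]

variable [Nonempty V]

theorem stateMean_weightedAverage (hG : G.Connected) (hV : 2 ≤ Fintype.card V) (x : V → ℤ)
    (t : ℕ) : stateMean G x t (weightedAverage G) = weightedAverage G x := by
  induction t with
  | zero => rw [stateMean_zero]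
  | succ t ih => rw [stateMean_succ, funext (stepMean_weightedAverage hG hV), ih]

theorem stateMean_sq_le (hG : G.Connected) (hV : 2 ≤ Fintype.card V) {k : ℕ} {x : V → ℤ}
    (hx : ∀ v, 1 ≤ x v ∧ x v ≤ k) (t : ℕ) :
    stateMean G x t (fun y => (weightedAverage G y - weightedAverage G x) ^ 2)
      ≤ t * ((∑ v, stationary G v ^ 2) / Fintype.card V) := by
  induction t with
  | zero => simp [stateMean_zero]
  | succ t ih =>
    rw [stateMean_succ]
    refine (stateMean_mono hx t fun y _ => stepMean_sq_le hG hV _ y).trans ?_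
    rw [stateMean_add, stateMean_const]
    push_cast
    linarith

theorem stateMean_spread_antitone (hG : G.Connected) (hV : 2 ≤ Fintype.card V) {k : ℕ}
    {x : V → ℤ} (hx : ∀ v, 1 ≤ x v ∧ x v ≤ k) (i : ℤ) :
    Antitone fun t => stateMean G x t (spread (stationary G) i) :=
  antitone_nat_of_succ_le fun t => by
    rw [stateMean_succ]
    exact stateMean_mono hx t fun y _ => stepMean_spread_le_self hG hV i y

/-- After suitably many steps, almost all opinions are `i` or `i + 1`. -/
theorem exists_stateMean_spread_le (hG : G.Connected) (hV : 2 ≤ Fintype.card V) {k : ℕ}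
    (hk : 1 ≤ k) {x : V → ℤ} (hx : ∀ v, 1 ≤ x v ∧ x v ≤ k) {i : ℤ}
    (hi1 : i ≤ weightedAverage G x) (hi2 : weightedAverage G x < i + 1) {ε : ℝ} (hε : 0 < ε)
    (hε1 : ε ≤ 1) :
    ∃ T, stateMean G x T (spread (stationary G) i) ≤ 2 * ε
      + 34 / ε * (16 * k * (2 * Real.log k - Real.log ε) / ε + 1) * ∑ v, stationary G v ^ 2
      + 16 / ε * (secondEigenvalue G * k) ^ 2 := by
  have hk1 : (1:ℝ) ≤ k := by exact_mod_cast hk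
  have hk0 : (0:ℝ) < k := by linarith
  have hn1 : (1:ℝ) ≤ Fintype.card V := by exact_mod_cast (by omega : 1 ≤ Fintype.card V)
  have hn : (0:ℝ) < Fintype.card V := by linarith
  have hπ := fun v => (stationary_pos hG hV v).le
  set S := ∑ v, stationary G v ^ 2 with hS
  have hS0 : 0 ≤ S := Finset.sum_nonneg fun v _ => sq_nonneg _
  set n : ℝ := (Fintype.card V : ℝ)
  set lam := secondEigenvalue G
  -- Chosen so that `exp(-τ) k² = ε`, where `k²` bounds the initial spread.
  set τ := 2 * Real.log k - Real.log ε with hτ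
  have hτ0 : 0 ≤ τ := by
    have := Real.log_nonneg hk1
    have := Real.log_nonpos hε.le hε1
    linarith
  set ρ := ε / (16 * k * n) with hρ
  have hρ0 : 0 < ρ := by positivity
  have hρ1 : ρ ≤ 1 := by
    rw [hρ, div_le_one (by positivity)]
    nlinarith
  set T := ⌈τ / ρ⌉₊ with hT
  have hT1 : τ / ρ ≤ T := Nat.le_ceil _
  have hT2 : (T : ℝ) ≤ τ / ρ + 1 := (Nat.ceil_lt_add_one (by positivity)).le
  set a : ℕ → ℝ := fun t => stateMean G x t (spread (stationary G) i) with ha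
  -- The fixed point of the affine recursion, with the variance of the mean bounded by its value at
  -- the final time `T`.
  set η := ε + 34 / ε * (T * S / n) + 16 / ε * (lam * k) ^ 2 with hη
  have hstep : ∀ t < T, a (t + 1) ≤ (1 - ρ) * a t + ρ * η := by
    intro t ht
    have h1 : a (t + 1) ≤ stateMean G x t fun y => ((1 - ρ) * spread (stationary G) i y
        + 17 / (8 * k * n) * (weightedAverage G y - weightedAverage G x) ^ 2)
        + (ε ^ 2 / (16 * k) + lam ^ 2 * k) / n := by
      simp only [ha]
      rw [stateMean_succ]
      exact stateMean_mono hx t fun y hy => stepMean_spread_le hG hV hk hy hi1 hi2.le hε hε1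
    rw [stateMean_add, stateMean_add, stateMean_const_mul, stateMean_const_mul,
      stateMean_const] at h1
    have h2 := stateMean_sq_le hG hV hx t
    have h3 : (t : ℝ) * (S / n) ≤ T * (S / n) := by
      have : (t : ℝ) ≤ T := by exact_mod_cast ht.le
      gcongr
    have h4 := mul_le_mul_of_nonneg_left (h2.trans h3)
      (show (0:ℝ) ≤ 17 / (8 * k * n) by positivity)
    have h5 : ρ * η = 17 / (8 * k * n) * (T * (S / n)) + (ε ^ 2 / (16 * k) + lam ^ 2 * k) / n := by
      rw [hρ, hη]
      field_simp
      ring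
    linarith
  have ha0 : a 0 ≤ (k : ℝ) ^ 2 := by
    simp only [ha, stateMean_zero]
    exact spread_le_sq hG hV hx hi1 hi2
  have ha00 : 0 ≤ a 0 := by
    simp only [ha, stateMean_zero]
    exact spread_nonneg hπ i
  have hη0 : 0 ≤ η := by positivity
  have hfin := le_pow_mul_add_of_le hρ1 hη0 hstep
  refine ⟨T, hfin.trans ?_⟩
  have hpow : (1 - ρ) ^ T * a 0 ≤ ε := by
    have h1 : (1 - ρ) ^ T ≤ Real.exp (-τ) := by
      calc (1 - ρ) ^ T ≤ (Real.exp (-ρ)) ^ T :=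
            pow_le_pow_left₀ (by linarith) (by linarith [Real.add_one_le_exp (-ρ)]) _
        _ = Real.exp (-(T * ρ)) := by rw [← Real.exp_nat_mul]; ring_nf
        _ ≤ Real.exp (-τ) := by
          rw [div_le_iff₀ hρ0] at hT1
          exact Real.exp_le_exp.2 (by linarith)
    have h2 : Real.exp (-τ) * (k : ℝ) ^ 2 = ε := by
      rw [hτ, neg_sub, Real.exp_sub, Real.exp_log hε,
        show 2 * Real.log k = Real.log k + Real.log k by ring, Real.exp_add, Real.exp_log hk0]
      field_simp
    rw [← h2]
    exact mul_le_mul h1 ha0 ha00 (Real.exp_pos _).le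
  have hTS : T * S / n ≤ (16 * k * τ / ε + 1) * S := by
    have h1 : T * S / n ≤ (τ / ρ + 1) * S / n := by gcongr
    have h2 : (τ / ρ + 1) * S / n = 16 * k * τ / ε * S + S / n := by
      rw [hρ]
      field_simp
    have h3 : S / n ≤ S := div_le_self hS0 hn1
    linarith
  have := mul_le_mul_of_nonneg_left hTS (show (0:ℝ) ≤ 34 / ε by positivity)
  rw [hη, mul_assoc]
  linarith

/-- The variance of the weighted average grows by at least `δ` times the probability of
non-consensus at each step, yet never exceeds `k²`. So these probabilities are summable. -/
theorem tendsto_not_consensus (hG : G.Connected) (hV : 2 ≤ Fintype.card V) {k : ℕ} {x : V → ℤ}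
    (hx : ∀ v, 1 ≤ x v ∧ x v ≤ k) :
    Tendsto (fun t => stateMean G x t fun y => if ∃ a, ∀ v, y v = a then 0 else 1) atTop
      (𝓝 0) := by
  set δ := (1 / (2 * (G.edgeFinset.card : ℝ))) ^ 2 / Fintype.card V with hδ
  have hδ0 : 0 < δ := by
    have hm : (0:ℝ) < G.edgeFinset.card := by exact_mod_cast card_edgeFinset_pos hG hV
    have hn : (0:ℝ) < Fintype.card V := by exact_mod_cast (by omega : 0 < Fintype.card V)
    positivity
  set N : ℕ → ℝ := fun t => stateMean G x t fun y => if ∃ a, ∀ v, y v = a then 0 else 1 with hN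
  have hN0 : ∀ t, 0 ≤ N t := by
    intro t
    rw [← stateMean_const (G := G) x t 0]
    exact stateMean_mono hx t fun y _ => by split_ifs <;> norm_num
  set c := weightedAverage G x with hc
  have hsum : ∀ t, δ * ∑ s ∈ Finset.range t, N s
      ≤ stateMean G x t (fun y => (weightedAverage G y - c) ^ 2) := by
    intro t
    induction t with
    | zero => simp [stateMean_zero, hc]
    | succ t ih =>
      rw [stateMean_succ, Finset.sum_range_succ, mul_add]
      have := stateMean_mono (G := G) hx t fun y _ => le_stepMean_sq hG hV c y
      rw [stateMean_add, stateMean_const_mul] at this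
      linarith
  have hbound : ∀ t, ∑ s ∈ Finset.range t, N s ≤ (k : ℝ) ^ 2 / δ := by
    intro t
    rw [le_div_iff₀ hδ0, mul_comm]
    refine (hsum t).trans ?_
    rw [← stateMean_const (G := G) x t ((k : ℝ) ^ 2)]
    refine stateMean_mono hx t fun y hy => ?_
    obtain ⟨h1, h2⟩ := weightedAverage_mem_box hG hV hy
    obtain ⟨h3, h4⟩ := weightedAverage_mem_box hG hV hx
    rw [← sq_abs]
    exact pow_le_pow_left₀ (abs_nonneg _) (abs_le.2 ⟨by linarith, by linarith⟩) 2
  exact (summable_of_sum_range_le hN0 hbound).tendsto_atTop_zero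

/-- The mean excess second moment at any time controls the law of the winner. -/
theorem abs_prob_wins_sub_le (hG : G.Connected) (hV : 2 ≤ Fintype.card V) {k : ℕ} {x : V → ℤ}
    (hx : ∀ v, 1 ≤ x v ∧ x v ≤ k) (i : ℤ) (T : ℕ) (a b : ℤ)
    (hab : (a = i ∧ b = i + 1) ∨ (a = i + 1 ∧ b = i)) :
    |prob G (Wins x a) - (b - weightedAverage G x) / (b - a)|
      ≤ stateMean G x T (spread (stationary G) i) := by
  set N : (V → ℤ) → ℝ := fun y => if ∃ a, ∀ v, y v = a then 0 else 1 with hN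
  set I : (V → ℤ) → ℝ := fun y => if ∀ v, y v = a then 1 else 0 with hI
  -- The affine function of the average that is `1` at consensus on `a` and `0` at consensus on `b`;
  -- its mean is constant in time.
  set W : (V → ℤ) → ℝ := fun y => (b - weightedAverage G y) / (b - a) with hW
  set K : ℝ := |(b : ℝ)| + k with hK
  have hba : ((b : ℝ) - a = 1 ∨ (b : ℝ) - a = -1) := by
    rcases hab with ⟨rfl, rfl⟩ | ⟨rfl, rfl⟩ <;> [left; right] <;> push_cast <;> ring
  -- At consensus the spread dominates the error by integrality; elsewhere the crude bound `K`
  -- suffices, as its weight vanishes in the limit.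
  have hpt : ∀ y : V → ℤ, (∀ v, 1 ≤ y v ∧ y v ≤ k) →
      |I y - W y| ≤ spread (stationary G) i y + K * N y := by
    intro y hy
    have hs := spread_nonneg (x := y) (fun v => (stationary_pos hG hV v).le) i
    by_cases hcons : ∃ z, ∀ v, y v = z
    · simp only [hN, if_pos hcons, mul_zero, add_zero]
      obtain ⟨z, hz⟩ := hcons
      have hIy : I y = if z = a then 1 else 0 := by
        obtain ⟨v⟩ := hG.nonempty
        simp only [hI]
        congr 1
        exact propext ⟨fun h => (hz v).symm.trans (h v), fun h v => (hz v).trans h⟩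
      rw [spread_of_consensus hG hV i hz, hIy]
      simp only [hW, weightedAverage_of_consensus hG hV hz]
      have key : ∀ u : ℤ, (u ≠ 0 → u ≠ 1 → |(u : ℝ)| ≤ u * (u - 1) ∧ |(u : ℝ) - 1| ≤ u * (u - 1)) := by
        intro u h0 h1
        have h2 : |u| ≤ u * (u - 1) ∧ |u - 1| ≤ u * (u - 1) := by
          rcases lt_or_gt_of_ne h0 with h | h
          · rw [abs_of_neg h, abs_of_neg (by omega)]
            constructor <;> nlinarith
          · have : 2 ≤ u := by omega
            rw [abs_of_pos h, abs_of_pos (by omega)]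
            constructor <;> nlinarith
        exact ⟨by exact_mod_cast h2.1, by exact_mod_cast h2.2⟩
      have hzi := key (z - i)
      push_cast at hzi
      rcases hab with ⟨rfl, rfl⟩ | ⟨rfl, rfl⟩
      · by_cases e0 : z = a
        · subst e0; simp
        · by_cases e1 : z = a + 1
          · subst e1; simp
          · have := (hzi (by omega) (by omega)).2
            rw [if_neg e0]
            push_cast
            rw [show (0 : ℝ) - (a + 1 - z) / (a + 1 - a) = z - a - 1 by
              rw [add_sub_cancel_left]; ring]
            exact this
      · by_cases e0 : z = b
        · subst e0; simp
        · by_cases e1 : z = b + 1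
          · subst e1; simp
          · have := (hzi (by omega) (by omega)).1
            rw [if_neg e1]
            push_cast
            rw [show (0 : ℝ) - (b - z) / (b - (b + 1)) = -(z - b) by
              rw [show (b : ℝ) - (b + 1) = -1 by ring]; ring, abs_neg]
            exact this
    · have hI0 : I y = 0 := if_neg fun h => hcons ⟨a, h⟩
      simp only [hN, if_neg hcons, mul_one, hI0, hW]
      obtain ⟨h1, h2⟩ := weightedAverage_mem_box hG hV hy
      have h3 : |0 - (b - weightedAverage G y) / ((b : ℝ) - a)| = |b - weightedAverage G y| := by
        rcases hba with h | h <;> rw [h, zero_sub, abs_neg, abs_div] <;> simp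
      rw [h3]
      have := abs_sub (b : ℝ) (weightedAverage G y)
      rw [abs_of_nonneg (by linarith : 0 ≤ weightedAverage G y)] at this
      linarith
  have hWmean : ∀ t, stateMean G x t W = (b - weightedAverage G x) / (b - a) := by
    intro t
    have : W = fun y => (b : ℝ) / (b - a) + (-1 / ((b : ℝ) - a)) * weightedAverage G y := by
      funext y
      simp only [hW]
      ring
    rw [this, stateMean_add, stateMean_const, stateMean_const_mul,
      stateMean_weightedAverage hG hV]
    ring
  have hbd : ∀ t, T ≤ t → |stateMean G x t I - (b - weightedAverage G x) / (b - a)|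
      ≤ stateMean G x T (spread (stationary G) i) + K * stateMean G x t N := by
    intro t ht
    have hanti := stateMean_spread_antitone hG hV hx i ht
    simp only at hanti
    have h1 := stateMean_mono (G := G) hx t (φ := I)
      (ψ := fun y => W y + (spread (stationary G) i y + K * N y)) fun y hy => by
        have := (abs_le.1 (hpt y hy)).2
        linarith
    have h2 := stateMean_mono (G := G) hx t (φ := W)
      (ψ := fun y => I y + (spread (stationary G) i y + K * N y)) fun y hy => by
        have := (abs_le.1 (hpt y hy)).1
        linarith
    rw [stateMean_add, stateMean_add, stateMean_const_mul, hWmean] at h1 h2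
    rw [abs_le]
    constructor <;> linarith
  have hlim1 : Tendsto (fun t => |stateMean G x t I - (b - weightedAverage G x) / (b - a)|) atTop
      (𝓝 |prob G (Wins x a) - (b - weightedAverage G x) / (b - a)|) :=
    ((tendsto_prob_wins x a).sub_const _).abs
  have hlim2 : Tendsto (fun t => stateMean G x T (spread (stationary G) i) + K * stateMean G x t N)
      atTop (𝓝 (stateMean G x T (spread (stationary G) i) + K * 0)) :=
    ((tendsto_not_consensus hG hV hx).const_mul K).const_add _
  rw [mul_zero, add_zero] at hlim2
  exact le_of_tendsto_of_tendsto hlim1 hlim2 (eventually_atTop.2 ⟨T, hbd⟩)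

/-- Consensus outside `{i, i + 1}` has spread at least `1`, so its probability is at most the mean
spread, which is nonincreasing in time. -/
theorem one_sub_le_prob_wins_union (hG : G.Connected) (hV : 2 ≤ Fintype.card V) {k : ℕ}
    {x : V → ℤ} (hx : ∀ v, 1 ≤ x v ∧ x v ≤ k) (i : ℤ) (T : ℕ) :
    1 - stateMean G x T (spread (stationary G) i) ≤ prob G (Wins x i ∪ Wins x (i + 1)) := by
  set N : (V → ℤ) → ℝ := fun y => if ∃ a, ∀ v, y v = a then 0 else 1 with hN
  have hbd : ∀ t, T ≤ t → 1 - stateMean G x T (spread (stationary G) i) - stateMean G x t N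
      ≤ prob G (Wins x i ∪ Wins x (i + 1)) := by
    intro t ht
    have hanti := stateMean_spread_antitone hG hV hx i ht
    simp only at hanti
    have hsub : {ω | (∀ v, opinions x ω t v = i) ∨ (∀ v, opinions x ω t v = i + 1)}
        ⊆ Wins x i ∪ Wins x (i + 1) := by
      rintro ω (h | h)
      · exact Or.inl ⟨t, h⟩
      · exact Or.inr ⟨t, h⟩
    have h1 := prob_mono (G := G) hsub
    rw [prob_state (G := G) x t fun y => (∀ v, y v = i) ∨ (∀ v, y v = i + 1)] at h1
    have h2 := stateMean_mono (G := G) hx t (φ := fun _ => 1)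
      (ψ := fun y => (if (∀ v, y v = i) ∨ (∀ v, y v = i + 1) then 1 else 0)
        + (spread (stationary G) i y + N y)) fun y hy => by
        have hs := spread_nonneg (x := y) (fun v => (stationary_pos hG hV v).le) i
        by_cases hcons : ∃ z, ∀ v, y v = z
        · simp only [hN, if_pos hcons, add_zero]
          split_ifs with h
          · linarith
          · obtain ⟨z, hz⟩ := hcons
            have hz0 : z ≠ i := fun e => h (Or.inl fun v => (hz v).trans e)
            have hz1 : z ≠ i + 1 := fun e => h (Or.inr fun v => (hz v).trans e)
            rw [spread_of_consensus hG hV i hz, zero_add]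
            have h2 : 1 ≤ (z - i) * (z - i - 1) := by
              rcases lt_or_gt_of_ne hz0 with h | h
              · nlinarith
              · have : i + 2 ≤ z := by omega
                nlinarith
            exact_mod_cast h2
        · simp only [hN, if_neg hcons]
          split_ifs <;> linarith
    rw [stateMean_add, stateMean_add, stateMean_const] at h2
    linarith
  have hlim : Tendsto (fun t => 1 - stateMean G x T (spread (stationary G) i) - stateMean G x t N)
      atTop (𝓝 (1 - stateMean G x T (spread (stationary G) i) - 0)) :=
    (tendsto_not_consensus hG hV hx).const_sub _
  rw [sub_zero] at hlim
  exact le_of_tendsto hlim (eventually_atTop.2 ⟨T, hbd⟩)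

end Limit

/-! ### Error terms in the two small parameters -/

theorem sum_sq_stationary_le {V : Type*} [Fintype V] {G : SimpleGraph V} (hG : G.Connected)
    (hV : 2 ≤ Fintype.card V) :
    ∑ v, stationary G v ^ 2 ≤ secondEigenvalue G ^ 2 + 2 / (Fintype.card V : ℝ)
      + 2 * secondEigenvalue G / √(Fintype.card V : ℝ) := by
  refine (isMixing_edgeMeasure hG hV).sum_sq_le (fun v => if_neg G.irrefl)
    (stationary_pos hG hV) (R := 1 / (2 * (G.edgeFinset.card : ℝ))) (fun v w => ?_)
    (by positivity) (by omega)
  unfold edgeMeasure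
  split_ifs
  · exact Or.inr rfl
  · exact Or.inl rfl

/-- The scale of the fluctuations of the weighted average in terms of the two small parameters
`lam * k` and `k * log n / n`. -/
theorem mul_one_add_log_mul_le {k n lam S : ℝ} (hk : 1 ≤ k) (hkn : k ≤ n) (hn : 1 ≤ Real.log n)
    (hlam : 0 ≤ lam) (hS : S ≤ lam ^ 2 + 2 / n + 2 * lam / √n) :
    k * (1 + Real.log k) * S ≤ (lam * k) ^ 2 + 4 * (k * Real.log n / n) + 4 * (lam * k) := by
  have hk0 : 0 < k := by linarith
  have hn0 : 0 < n := by linarith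
  have hs0 : 0 < √n := Real.sqrt_pos.2 hn0
  have hl0 : 0 ≤ Real.log k := Real.log_nonneg hk
  have hlk : Real.log k ≤ k - 1 := Real.log_le_sub_one_of_pos hk0
  have hlkn : Real.log k ≤ Real.log n := Real.log_le_log hk0 hkn
  -- Lets the `1/√n` in the cross term of the bound on `S` absorb the factor `1 + log k`.
  have hls : Real.log n ≤ 2 * (√n - 1) := by
    have h1 := Real.log_le_sub_one_of_pos hs0
    have h2 : Real.log n = 2 * Real.log √n := by
      rw [Real.log_sqrt hn0.le]
      ring
    linarith
  have hpos : 0 ≤ k * (1 + Real.log k) := by positivity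
  refine (mul_le_mul_of_nonneg_left hS hpos).trans ?_
  have h1 : k * (1 + Real.log k) * lam ^ 2 ≤ (lam * k) ^ 2 := by
    have : k * (1 + Real.log k) ≤ k * k := mul_le_mul_of_nonneg_left (by linarith) hk0.le
    have := mul_le_mul_of_nonneg_right this (sq_nonneg lam)
    linarith
  have h2 : k * (1 + Real.log k) * (2 / n) ≤ 4 * (k * Real.log n / n) := by
    have e1 : k * (1 + Real.log k) * (2 / n) = (2 * (1 + Real.log k)) * k / n := by ring
    have e2 : 4 * (k * Real.log n / n) = (4 * Real.log n) * k / n := by ring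
    have e3 : 2 * (1 + Real.log k) ≤ 4 * Real.log n := by linarith
    rw [e1, e2]
    gcongr
  have h3 : k * (1 + Real.log k) * (2 * lam / √n) ≤ 4 * (lam * k) := by
    rw [← mul_div_assoc, div_le_iff₀ hs0]
    have : (lam * k) * (1 + Real.log k) ≤ (lam * k) * (2 * √n) :=
      mul_le_mul_of_nonneg_left (by linarith) (by positivity)
    linarith
  linarith

/-- A quantitative form of `exists_stateMean_spread_le` in the two small parameters. -/
theorem exists_stateMean_spread_le_of_params {V : Type*} [Fintype V] [Nonempty V]
    {G : SimpleGraph V} (hG : G.Connected) (hV : 2 ≤ Fintype.card V) {k : ℕ} {x : V → ℤ}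
    (hx : ∀ v, 1 ≤ x v ∧ x v ≤ k) {i : ℤ} (hi1 : i ≤ weightedAverage G x)
    (hi2 : weightedAverage G x < i + 1) {ε : ℝ} (hε : 0 < ε) (hε1 : ε ≤ 1)
    (hkn : (k : ℝ) ≤ Fintype.card V) (hn : 1 ≤ Real.log (Fintype.card V)) :
    ∃ T, stateMean G x T (spread (stationary G) i) ≤ 2 * ε
      + 34 / ε * (16 * (2 - Real.log ε) / ε + 1) * ((secondEigenvalue G * k) ^ 2
        + 4 * (k * Real.log (Fintype.card V) / Fintype.card V) + 4 * (secondEigenvalue G * k))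
      + 16 / ε * (secondEigenvalue G * k) ^ 2 := by
  have hk : 1 ≤ k := by
    obtain ⟨v⟩ := hG.nonempty
    have := hx v
    omega
  obtain ⟨T, hT⟩ := exists_stateMean_spread_le hG hV hk hx hi1 hi2 hε hε1
  refine ⟨T, hT.trans ?_⟩
  have hk1 : (1:ℝ) ≤ k := by exact_mod_cast hk
  have hlam : 0 ≤ secondEigenvalue G := NNReal.coe_nonneg _
  have hZ := mul_one_add_log_mul_le hk1 hkn hn hlam (sum_sq_stationary_le hG hV)
  have hS0 : 0 ≤ ∑ v, stationary G v ^ 2 := Finset.sum_nonneg fun v _ => sq_nonneg _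
  have hl0 : 0 ≤ Real.log k := Real.log_nonneg hk1
  have hle : Real.log ε ≤ 0 := Real.log_nonpos hε.le hε1
  set S := ∑ v, stationary G v ^ 2
  have h1 : 16 * k * (2 * Real.log k - Real.log ε) / ε + 1
      ≤ (16 * (2 - Real.log ε) / ε + 1) * (k * (1 + Real.log k)) := by
    have e1 : 2 * Real.log k - Real.log ε ≤ (2 - Real.log ε) * (1 + Real.log k) := by nlinarith
    have e2 : 16 * k * (2 * Real.log k - Real.log ε) / ε
        ≤ 16 * k * ((2 - Real.log ε) * (1 + Real.log k)) / ε := by gcongr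
    have e3 : 1 ≤ k * (1 + Real.log k) := by nlinarith
    have e4 : 16 * k * ((2 - Real.log ε) * (1 + Real.log k)) / ε
        = 16 * (2 - Real.log ε) / ε * (k * (1 + Real.log k)) := by ring
    linarith
  have h2 : (16 * k * (2 * Real.log k - Real.log ε) / ε + 1) * S
      ≤ (16 * (2 - Real.log ε) / ε + 1) * (k * (1 + Real.log k) * S) := by
    have := mul_le_mul_of_nonneg_right h1 hS0
    linarith
  have hc : 0 ≤ 16 * (2 - Real.log ε) / ε + 1 := by
    have : 0 ≤ 2 - Real.log ε := by linarith
    positivity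
  have h3 := h2.trans (mul_le_mul_of_nonneg_left hZ hc)
  have h4 := mul_le_mul_of_nonneg_left h3 (show (0:ℝ) ≤ 34 / ε by positivity)
  linarith

end IncrementalVoting

/-! ### Passage to the limit -/

theorem theorem2 (V : ℕ → Type*) [∀ j, Fintype (V j)] [∀ j, Nonempty (V j)]
    (G : ∀ j, SimpleGraph (V j)) (k : ℕ → ℕ) (x : ∀ j, V j → ℤ)
    (c : ℕ → ℝ) (i : ℕ → ℤ) (p q : ℕ → ℝ)
    (hconn : ∀ j, (G j).Connected)
    (hn : Tendsto (fun j => Fintype.card (V j)) atTop atTop)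
    (hx : ∀ j v, 1 ≤ x j v ∧ x j v ≤ (k j : ℤ))
    (hlam : (fun j => IncrementalVoting.secondEigenvalue (G j) * (k j : ℝ))
      =o[atTop] (fun _ => (1 : ℝ)))
    (hk : (fun j => (k j : ℝ))
      =o[atTop] (fun j => (Fintype.card (V j) : ℝ) / Real.log (Fintype.card (V j))))
    (hpi : (fun j => IncrementalVoting.stationaryMin (G j))
      =Θ[atTop] (fun j => 1 / (Fintype.card (V j) : ℝ)))
    (hc : ∀ j, c j = IncrementalVoting.weightedAverage (G j) (x j))
    (hi : ∀ j, (i j : ℝ) ≤ c j ∧ c j < (i j : ℝ) + 1)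
    (hp : ∀ j, p j = IncrementalVoting.prob (G j) (IncrementalVoting.Wins (x j) (i j)))
    (hq : ∀ j, q j = IncrementalVoting.prob (G j) (IncrementalVoting.Wins (x j) (i j + 1))) :
    -- with high probability the winning opinion is `i` or `i + 1`
    Tendsto (fun j => IncrementalVoting.prob (G j)
      (IncrementalVoting.Wins (x j) (i j) ∪ IncrementalVoting.Wins (x j) (i j + 1)))
      atTop (𝓝 1) ∧
    -- `p = i + 1 - c + o(1)` and `q = c - i + o(1)`
    (fun j => p j - ((i j : ℝ) + 1 - c j)) =o[atTop] (fun _ => (1 : ℝ)) ∧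
    (fun j => q j - (c j - (i j : ℝ))) =o[atTop] (fun _ => (1 : ℝ)) ∧
    -- `p ~ i + 1 - c` and `q ~ c - i` where these quantities stay away from zero
    (∀ δ : ℝ, 0 < δ → (∀ᶠ j in atTop, δ ≤ (i j : ℝ) + 1 - c j) →
      p ~[atTop] fun j => (i j : ℝ) + 1 - c j) ∧
    (∀ δ : ℝ, 0 < δ → (∀ᶠ j in atTop, δ ≤ c j - (i j : ℝ)) →
      q ~[atTop] fun j => c j - (i j : ℝ)) := by
  have hcard3 : ∀ᶠ j in atTop, 3 ≤ Fintype.card (V j) := hn.eventually_ge_atTop 3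
  have hlog : ∀ᶠ j in atTop, 1 ≤ Real.log (Fintype.card (V j)) := by
    filter_upwards [hcard3] with j hj
    have h3 : (3:ℝ) ≤ Fintype.card (V j) := by exact_mod_cast hj
    rw [Real.le_log_iff_exp_le (by linarith)]
    linarith [Real.exp_one_lt_d9]
  have hu : Tendsto (fun j => IncrementalVoting.secondEigenvalue (G j) * (k j : ℝ)) atTop (𝓝 0) :=
    (isLittleO_one_iff ℝ).1 hlam
  have hw : Tendsto (fun j => (k j : ℝ) * Real.log (Fintype.card (V j)) / Fintype.card (V j))
      atTop (𝓝 0) := by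
    refine hk.tendsto_div_nhds_zero.congr fun j => ?_
    rw [div_div_eq_mul_div]
  have hkn : ∀ᶠ j in atTop, (k j : ℝ) ≤ Fintype.card (V j) := by
    filter_upwards [hw.eventually_lt_const one_pos, hlog, hcard3] with j h1 h2 h3
    have h4 : (0:ℝ) < Fintype.card (V j) := by exact_mod_cast (by omega : 0 < Fintype.card (V j))
    rw [div_lt_one h4] at h1
    have : (0:ℝ) ≤ k j := Nat.cast_nonneg _
    nlinarith
  have hsmall : ∀ ε : ℝ, 0 < ε → ∀ᶠ j in atTop, 2 ≤ Fintype.card (V j) ∧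
      ∃ T, IncrementalVoting.stateMean (G j) (x j) T
        (IncrementalVoting.spread (IncrementalVoting.stationary (G j)) (i j)) ≤ ε := by
    intro ε₀ hε₀
    -- For fixed `ε` the error terms vanish as `j → ∞` and the bound tends to `2ε`, hence is
    -- eventually below `3ε ≤ ε₀`.
    set ε := min (ε₀ / 3) 1 with hε
    have hε0 : 0 < ε := lt_min (by linarith) one_pos
    have hε1 : ε ≤ 1 := min_le_right _ _
    have hε3 : ε ≤ ε₀ / 3 := min_le_left _ _
    have hlim := ((((hu.pow 2).add (hw.const_mul 4)).add (hu.const_mul 4)).const_mul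
      (34 / ε * (16 * (2 - Real.log ε) / ε + 1))).const_add (2 * ε) |>.add
      ((hu.pow 2).const_mul (16 / ε))
    have hlt : 2 * ε + 34 / ε * (16 * (2 - Real.log ε) / ε + 1) * (0 ^ 2 + 4 * 0 + 4 * 0)
        + 16 / ε * 0 ^ 2 < 3 * ε := by
      simp only [ne_eq, OfNat.ofNat_ne_zero, not_false_eq_true, zero_pow, mul_zero, add_zero]
      linarith
    filter_upwards [hcard3, hlog, hkn, hlim.eventually_lt_const hlt] with j h3 h1 h2 h4
    refine ⟨by omega, ?_⟩
    have hij := hi j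
    rw [hc j] at hij
    obtain ⟨T, hT⟩ := IncrementalVoting.exists_stateMean_spread_le_of_params (hconn j)
      (by omega) (hx j) hij.1 hij.2 hε0 hε1 h2 h1
    exact ⟨T, by linarith⟩
  have hp0 : Tendsto (fun j => p j - ((i j : ℝ) + 1 - c j)) atTop (𝓝 0) := by
    rw [Metric.tendsto_nhds]
    intro ε hε
    filter_upwards [hsmall (ε / 2) (by linarith)] with j hj
    obtain ⟨h2, T, hT⟩ := hj
    have := IncrementalVoting.abs_prob_wins_sub_le (hconn j) h2 (hx j) (i j) T (i j) (i j + 1)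
      (Or.inl ⟨rfl, rfl⟩)
    rw [← hp, ← hc, Int.cast_add, Int.cast_one, add_sub_cancel_left, div_one] at this
    rw [Real.dist_eq, sub_zero]
    linarith
  have hq0 : Tendsto (fun j => q j - (c j - (i j : ℝ))) atTop (𝓝 0) := by
    rw [Metric.tendsto_nhds]
    intro ε hε
    filter_upwards [hsmall (ε / 2) (by linarith)] with j hj
    obtain ⟨h2, T, hT⟩ := hj
    have := IncrementalVoting.abs_prob_wins_sub_le (hconn j) h2 (hx j) (i j) T (i j + 1) (i j)
      (Or.inr ⟨rfl, rfl⟩)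
    rw [← hq, ← hc, Int.cast_add, Int.cast_one, sub_add_cancel_left, div_neg, div_one, neg_sub]
      at this
    rw [Real.dist_eq, sub_zero]
    linarith
  have hequiv : ∀ f g : ℕ → ℝ, Tendsto (fun j => f j - g j) atTop (𝓝 0) → ∀ δ : ℝ, 0 < δ →
      (∀ᶠ j in atTop, δ ≤ g j) → f ~[atTop] g := by
    intro f g hfg δ hδ hg
    refine ((isLittleO_one_iff ℝ).2 hfg).trans_isBigO (IsBigO.of_bound (1 / δ) ?_)
    filter_upwards [hg] with j hj
    rw [norm_one, Real.norm_of_nonneg (hδ.le.trans hj), one_div_mul_eq_div, le_div_iff₀ hδ]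
    linarith
  refine ⟨?_, (isLittleO_one_iff ℝ).2 hp0, (isLittleO_one_iff ℝ).2 hq0,
    hequiv _ _ hp0, hequiv _ _ hq0⟩
  rw [Metric.tendsto_nhds]
  intro ε hε
  filter_upwards [hsmall (ε / 2) (by linarith)] with j hj
  obtain ⟨h2, T, hT⟩ := hj
  have h3 := IncrementalVoting.one_sub_le_prob_wins_union (hconn j) h2 (hx j) (i j) T
  have h4 := IncrementalVoting.prob_le_one (G := G j)
    (IncrementalVoting.Wins (x j) (i j) ∪ IncrementalVoting.Wins (x j) (i j + 1))
  rw [Real.dist_eq, abs_lt]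
  constructor <;> linarith
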